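/- Let $N\ge 1$ be an integer, $0<\alpha<1$, and $f\in L^1(\mathbb R^N)$ real-valued, $M:=\int_{\mathbb R^N} f(x)\,dx$. For $h>0$ and a sequence $v$ on the mesh $\{0,h,2h,\dots\}$ let $${}_C\delta^\alpha v(nh):=h^{1-\alpha}\sum_{j=1}^n k^{1-\alpha}(n-j)\,\frac{v(jh)-v((j-1)h)}{h},\qquad k^{a}(m):=\frac{a(a+1)\cdots(a+m-1)}{m!},\qquad n\ge 1 .$$ Let $u$ be the $L^1$ solution of $${}_C\delta^\alpha u(nh,\cdot)=\Delta u(nh,\cdot)\quad(n\ge 1),\qquad u(0,\cdot)=f,$$ that is, $u(nh,\cdot)\in L^1(\mathbb R^N)$ for all $n\ge0$ and the equation holds in the sense of distributions on $\mathbb R^N$. Let $\mathcal G^\alpha_{n,h}\in L^1(\mathbb R^N)$, $n\ge 1$, be the fundamental solution, i.e. the solution of the same problem, in the sense of distributions, with the Dirac mass $\delta_0$ as initial datum. Well-posedness: for every $h>0$ both $\mathcal G^\alpha_{n,h}$ and $u$ exist and are unique up to null sets, and $u(nh,\cdot)=\mathcal G^\alpha_{n,h}*f$ almost everywhere for $n\ge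 1$. If $h^{1-\alpha}<2$, then $$\mathcal G^\alpha_{n,h}(x)=\sum_{j=1}^\infty \varphi^h_{\alpha,1-\alpha}(n-1,j-1)\,\mathcal G_{j,h}(x)\qquad\text{for a.e. } x,$$ the series being absolutely convergent for every $x\ne0$; here $$\mathcal G_{j,h}(x)=\frac{1}{h^j\Gamma(j)}\int_0^\infty e^{-t/h}t^{j-1}\,\frac{e^{-|x|^2/(4t)}}{(4\pi t)^{N/2}}\,dt,$$ and $\varphi^h_{\alpha,\beta}(n,j)$ is the $n$-th Taylor coefficient at $0$ of $z\mapsto \bigl(1-h(\tfrac{1-z}{h})^\alpha\bigr)^j\,(\tfrac{1-z}{h})^{-\beta}$ (principal powers). Large-time behaviour: let $p\in[1,\infty)$ if $N=1$, and $p\in[1,\tfrac{N}{N-1})$ if $N>1$. (i) For every $h>0$, $$(nh)^{\frac{\alpha N}{2}\left(1-\frac1p\right)}\,\bigl\|u(nh,\cdot)-M\,\mathcal G^\alpha_{n,h}\bigr\|_{L^p(\mathbb R^N)}\longrightarrow 0\qquad (n\to\infty).$$ (ii) If in addition $|x|f\in L^1(\mathbb R^N)$, then there is a constant $C$, depending only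 on $\alpha,N,p,f$, such that for all $h>0$ and all $n\ge 1$ $$(nh)^{\frac{\alpha N}{2}\left(1-\frac1p\right)}\,\bigl\|u(nh,\cdot)-M\,\mathcal G^\alpha_{n,h}\bigr\|_{L^p(\mathbb R^N)}\le C\,(nh)^{-\alpha/2}.$$ -/

import Mathlib

open MeasureTheory Filter Topology
open scoped ENNReal ContDiff

namespace DiscreteFracHeat

noncomputable section

/-- The space `ℝ^N` with the Euclidean norm. -/
abbrev Sp (N : ℕ) : Type := EuclideanSpace ℝ (Fin N)

/-! Discrete fractional calculus on the mesh `{0, h, 2h, …}`: a sequence `v : ℕ → ℝ` stands for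
the mesh function `nh ↦ v n`. -/

/-- Cesàro numbers `k^a(n) = a (a+1) ⋯ (a+n-1) / n!`. -/
def cesaro (a : ℝ) (n : ℕ) : ℝ :=
  (∏ i ∈ Finset.range n, (a + (i : ℝ))) / (n.factorial : ℝ)

/-- The fractional sum `δ^{-a} v (nh) = h^a ∑_{j=1}^n k^a(n-j) v(jh)`. -/
def fracSum (a h : ℝ) (v : ℕ → ℝ) (n : ℕ) : ℝ :=
  h ^ a * ∑ j ∈ Finset.Icc 1 n, cesaro a (n - j) * v j

/-- The backward difference `(v(nh) - v((n-1)h)) / h`, meant for `n ≥ 1`. -/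
def backDiff (h : ℝ) (v : ℕ → ℝ) (n : ℕ) : ℝ :=
  (v n - v (n - 1)) / h

/-- The Caputo fractional `h`-difference of order `α`, meant for `n ≥ 1`. -/
def caputo (α h : ℝ) (v : ℕ → ℝ) (n : ℕ) : ℝ :=
  fracSum (1 - α) h (backDiff h v) n

/-! The equation. -/

/-- `g` is the Laplacian of `v` in the sense of distributions on `ℝ^N`. -/
def HasWeakLaplacian {N : ℕ} (v g : Sp N → ℝ) : Prop :=
  ∀ φ : Sp N → ℝ, ContDiff ℝ ∞ φ → HasCompactSupport φ →
    ∫ x, v x * Laplacian.laplacian φ x = ∫ x, g x * φ x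

/-- `u` (with `u n x` standing for `u(nh, x)`) is an `L¹` solution of
`_C δ^α u(nh, ·) = Δ u(nh, ·)` for `n ≥ 1`, `u(0, ·) = f`. -/
structure IsSolution {N : ℕ} (α h : ℝ) (f : Sp N → ℝ) (u : ℕ → Sp N → ℝ) : Prop where
  integrable : ∀ n, Integrable (u n)
  initial : u 0 =ᵐ[volume] f
  equation : ∀ n, 1 ≤ n →
    HasWeakLaplacian (u n) (fun x => caputo α h (fun m => u m x) n)

/-- `K` is an `L¹` fundamental solution: it satisfies the equation in the sense of distributions,
with the Dirac mass at the origin as initial datum. The value `K 0` plays no role. -/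
structure IsFundamentalSolution {N : ℕ} (α h : ℝ) (K : ℕ → Sp N → ℝ) : Prop where
  integrable : ∀ n, 1 ≤ n → Integrable (K n)
  equation : ∀ n, 1 ≤ n → ∀ φ : Sp N → ℝ, ContDiff ℝ ∞ φ → HasCompactSupport φ →
    caputo α h (fun m => if m = 0 then φ 0 else ∫ x, K m x * φ x) n =
      ∫ x, K n x * Laplacian.laplacian φ x

/-! The subordination series. -/

/-- The Gaussian kernel `G_t(x) = (4πt)^{-N/2} e^{-|x|²/(4t)}`. -/
def gaussKernel {N : ℕ} (t : ℝ) (x : Sp N) : ℝ :=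
  (4 * Real.pi * t) ^ (-((N : ℝ) / 2)) * Real.exp (-(‖x‖ ^ 2 / (4 * t)))

/-- The discrete Gaussian kernel
`𝒢_{n,h}(x) = (h^n Γ(n))⁻¹ ∫_0^∞ e^{-t/h} t^{n-1} G_t(x) dt`, for `n ≥ 1`, `x ≠ 0`. -/
def discreteGauss {N : ℕ} (h : ℝ) (n : ℕ) (x : Sp N) : ℝ :=
  (h ^ n * Real.Gamma (n : ℝ))⁻¹ *
    ∫ t in Set.Ioi (0 : ℝ), Real.exp (-(t / h)) * t ^ (n - 1) * gaussKernel t x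

/-- The discrete scaled Wright function `φ^h_{α,β}(n,j)`: the `n`-th Taylor coefficient at `0` of
`(1 - h ((1-z)/h)^α)^j / ((1-z)/h)^β`, written as a Cauchy integral over the circle of radius `1/2`
(the integrand is holomorphic in the punctured unit disc, so every radius in `(0,1)` gives the same
value, and this value is real). -/
def wright (α β h : ℝ) (n j : ℕ) : ℝ :=
  ((2 * (Real.pi : ℂ) * Complex.I)⁻¹ * ∮ z in C(0, 1 / 2),
    (z ^ (n + 1))⁻¹ * ((1 - (h : ℂ) * ((1 - z) / (h : ℂ)) ^ (α : ℂ)) ^ j /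
      ((1 - z) / (h : ℂ)) ^ (β : ℂ))).re

/-- The kernel
`𝒢^α_{n,h}(x) = ∑_{j ≥ 1} φ^h_{α,1-α}(n-1,j-1) 𝒢_{j,h}(x)`, for `n ≥ 1`, `x ≠ 0`. -/
def subordKernel {N : ℕ} (α h : ℝ) (n : ℕ) (x : Sp N) : ℝ :=
  ∑' j : ℕ, wright α (1 - α) h (n - 1) j * discreteGauss h (j + 1) x

end

end DiscreteFracHeat

/-! By summation by parts the Caputo difference is an implicit scheme, `caputo α h v n = h ^ (-α) *
(v n - ∑ j < n, w n j * v j)`. Its weights `histWeight` are nonnegative, because the Cesàro numbers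
of order `1 - α` decrease. A weak equation between integrable functions is equivalent to an identity
of Fourier transforms, so the problem becomes, for each frequency, the scalar recursion `(1 + h ^ α
* κ) * s n = ∑ j < n, w n j * s j` with `κ = 4π²|ξ|²`. The factor on the left never vanishes. This
gives uniqueness, and it gives the convolution formula by comparing initial values.

Existence for every `h` comes from positivity. Unrolling the recursion writes `s n` as a polynomial
in `1 / (1 + h ^ α * κ)` with nonnegative coefficients `jumpProb`. The power `i` of that quantity is
the Laplace transform of a Gamma law, so the fundamental solution is a Gaussian mixture `mix
(mixMeasure α h n)`. The subordination series solves the same recursion: its generating function is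
a geometric series with ratio `(1 - h ((1-z)/h)^α) / (1 + h κ)`. The condition `h ^ (1 - α) < 2`
makes the Wright coefficients decay geometrically.

The asymptotics rest on `implicit_scheme_le`: the Laplace transform of the mixing measure is at most
`1 / (1 + κ (nh)^α)`, that of an exponential law of mean `(nh)^α`. Integrating in `κ` bounds every
negative moment of order `γ < 1` by `Γ(1-γ) (nh)^(-αγ)`, uniformly in `h`. Minkowski's inequality
transfers this to the `L^p` norm of the kernel, with `γ = N/2 (1 - 1/p)`. It also transfers to the
kernel's increments, where a gradient costs a further `1/2`. The requirement `γ + 1/2 < 1` is the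
stated range of `p`. Finally `u - M K` is the average of the increments `K(· - y) - K` against `f`.
The Lipschitz bound gives the rate when `f` has a first moment, and dominated convergence gives the
limit in general. -/

namespace DiscreteFracHeat

noncomputable section

/-! ### Cesàro numbers -/

@[simp] lemma cesaro_zero_right (a : ℝ) : cesaro a 0 = 1 := by simp [cesaro]

lemma cesaro_succ (a : ℝ) (n : ℕ) : cesaro a (n + 1) = cesaro a n * ((a + n) / (n + 1)) := by
  have h : (n.factorial : ℝ) ≠ 0 := by positivity
  simp only [cesaro, Finset.prod_range_succ, Nat.factorial_succ]
  push_cast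
  field_simp

lemma cesaro_nonneg {a : ℝ} (ha : 0 ≤ a) (n : ℕ) : 0 ≤ cesaro a n :=
  div_nonneg (Finset.prod_nonneg fun i _ => by positivity) (by positivity)

lemma cesaro_one (n : ℕ) : cesaro 1 n = 1 := by
  induction n with
  | zero => simp
  | succ n ih =>
    rw [cesaro_succ, ih]
    field_simp
    ring

lemma cesaro_succ_le {a : ℝ} (ha : 0 ≤ a) (ha1 : a ≤ 1) (n : ℕ) :
    cesaro a (n + 1) ≤ cesaro a n := by
  rw [cesaro_succ]
  refine mul_le_of_le_one_right (cesaro_nonneg ha n) ?_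
  rw [div_le_one (by positivity)]
  linarith

/-- Bernoulli's inequality for exponents in `[0, 1]` compares the growth factors of the two sides
from one index to the next. -/
lemma rpow_le_cesaro {α : ℝ} (h0 : 0 ≤ α) (h1 : α ≤ 1) (n : ℕ) :
    ((n : ℝ) + 1) ^ α ≤ cesaro (α + 1) n := by
  induction n with
  | zero => simp
  | succ n ih =>
    have hn : (0 : ℝ) < n + 1 := by positivity
    have hB : (1 + 1 / ((n : ℝ) + 1)) ^ α ≤ 1 + α * (1 / ((n : ℝ) + 1)) :=
      rpow_one_add_le_one_add_mul_self (by
        have : 0 ≤ 1 / ((n : ℝ) + 1) := by positivity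
        linarith) h0 h1
    have e : ((n + 1 : ℕ) : ℝ) + 1 = (n + 1) * (1 + 1 / ((n : ℝ) + 1)) := by
      push_cast
      field_simp
    rw [e, Real.mul_rpow hn.le (by positivity), cesaro_succ]
    have e2 : (α + 1 + n) / ((n : ℝ) + 1) = 1 + α * (1 / ((n : ℝ) + 1)) := by
      field_simp
      ring
    rw [e2]
    exact mul_le_mul ih hB (by positivity) (cesaro_nonneg (by linarith) n)

/-! ### Taylor coefficients at the origin -/

/-- The `n`-th Taylor coefficient of `F` at `0`. -/
def taylorCoeff (n : ℕ) (F : ℂ → ℂ) : ℂ := iteratedDeriv n F 0 / (n.factorial : ℂ)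

lemma taylorCoeff_congr {F G : ℂ → ℂ} (h : F =ᶠ[𝓝 0] G) (n : ℕ) :
    taylorCoeff n F = taylorCoeff n G := by
  rw [taylorCoeff, taylorCoeff, h.iteratedDeriv_eq n]

lemma taylorCoeff_mul {F G : ℂ → ℂ} (hF : AnalyticAt ℂ F 0) (hG : AnalyticAt ℂ G 0) (n : ℕ) :
    taylorCoeff n (fun z => F z * G z) =
      ∑ i ∈ Finset.range (n + 1), taylorCoeff i F * taylorCoeff (n - i) G := by
  have := iteratedDeriv_fun_mul (n := n) (hF.contDiffAt) (hG.contDiffAt)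
  rw [taylorCoeff, this, Finset.sum_div]
  refine Finset.sum_congr rfl fun i hi => ?_
  have hi' : i ≤ n := Nat.lt_succ_iff.mp (Finset.mem_range.mp hi)
  rw [Nat.cast_choose ℂ hi', taylorCoeff, taylorCoeff]
  have h1 : (n.factorial : ℂ) ≠ 0 := by exact_mod_cast n.factorial_ne_zero
  have h2 : (i.factorial : ℂ) ≠ 0 := by exact_mod_cast i.factorial_ne_zero
  have h3 : ((n - i).factorial : ℂ) ≠ 0 := by exact_mod_cast (n - i).factorial_ne_zero
  field_simp

lemma taylorCoeff_const_mul {F : ℂ → ℂ} (c : ℂ) (n : ℕ) :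
    taylorCoeff n (fun z => c * F z) = c * taylorCoeff n F := by
  rw [taylorCoeff, iteratedDeriv_const_mul_field, taylorCoeff, mul_div_assoc]

lemma taylorCoeff_sub {F G : ℂ → ℂ} (hF : AnalyticAt ℂ F 0) (hG : AnalyticAt ℂ G 0) (n : ℕ) :
    taylorCoeff n (fun z => F z - G z) = taylorCoeff n F - taylorCoeff n G := by
  rw [taylorCoeff, iteratedDeriv_fun_sub hF.contDiffAt hG.contDiffAt, sub_div, taylorCoeff,
    taylorCoeff]

lemma taylorCoeff_sum {ι : Type*} (s : Finset ι) {F : ι → ℂ → ℂ}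
    (hF : ∀ i ∈ s, AnalyticAt ℂ (F i) 0) (n : ℕ) :
    taylorCoeff n (fun z => ∑ i ∈ s, F i z) = ∑ i ∈ s, taylorCoeff n (F i) := by
  rw [taylorCoeff, iteratedDeriv_fun_sum fun i hi => (hF i hi).contDiffAt, Finset.sum_div]
  rfl

lemma one_sub_mem_slitPlane {z : ℂ} (hz : ‖z‖ < 1) : 1 - z ∈ Complex.slitPlane := by
  left
  have := (Complex.abs_re_le_norm z).trans_lt hz
  simp only [Complex.sub_re, Complex.one_re]
  linarith [(abs_lt.mp this).2]

lemma analyticAt_one_sub_cpow (a : ℂ) {z : ℂ} (hz : ‖z‖ < 1) :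
    AnalyticAt ℂ (fun z : ℂ => (1 - z) ^ a) z :=
  (analyticAt_const.sub analyticAt_id).cpow analyticAt_const (one_sub_mem_slitPlane hz)

/-- Only the value at the origin is needed, but the induction differentiates the formula and so must
have it on a neighbourhood. -/
lemma iteratedDeriv_one_sub_cpow (a : ℂ) (n : ℕ) {z : ℂ} (hz : ‖z‖ < 1) :
    iteratedDeriv n (fun z : ℂ => (1 - z) ^ (-a)) z =
      (∏ i ∈ Finset.range n, (a + i)) * (1 - z) ^ (-a - n) := by
  induction n generalizing z with
  | zero => simp
  | succ n ih =>
    rw [iteratedDeriv_succ]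
    have hev : iteratedDeriv n (fun z : ℂ => (1 - z) ^ (-a)) =ᶠ[𝓝 z]
        fun z => (∏ i ∈ Finset.range n, (a + i)) * (1 - z) ^ (-a - n) := by
      filter_upwards [(isOpen_lt continuous_norm continuous_const).mem_nhds hz] with w hw
      exact ih hw
    rw [hev.deriv_eq, deriv_const_mul_field]
    have hd : HasDerivAt (fun z : ℂ => (1 - z) ^ (-a - n))
        ((-a - n) * (1 - z) ^ (-a - n - 1) * (-1)) z :=
      ((hasDerivAt_id z).const_sub 1).cpow_const (one_sub_mem_slitPlane hz)
    rw [hd.deriv, Finset.prod_range_succ]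
    push_cast
    rw [show -a - ((n : ℂ) + 1) = -a - n - 1 by ring]
    ring

lemma taylorCoeff_one_sub_cpow (a : ℝ) (n : ℕ) :
    taylorCoeff n (fun z : ℂ => (1 - z) ^ (-(a : ℂ))) = (cesaro a n : ℂ) := by
  rw [taylorCoeff, iteratedDeriv_one_sub_cpow _ _ (by simp), cesaro]
  simp

lemma one_sub_eventually {P : ℂ → Prop} (h : ∀ z : ℂ, ‖z‖ < 1 → P z) : ∀ᶠ z in 𝓝 (0 : ℂ), P z := by
  filter_upwards [(isOpen_lt continuous_norm continuous_const).mem_nhds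
    (show ‖(0 : ℂ)‖ < 1 by simp)] with z hz
  exact h z hz

/-- The Vandermonde convolution identity for Cesàro numbers. -/
lemma sum_cesaro_mul_cesaro (a b : ℝ) (n : ℕ) :
    ∑ i ∈ Finset.range (n + 1), cesaro a i * cesaro b (n - i) = cesaro (a + b) n := by
  have h := taylorCoeff_mul (analyticAt_one_sub_cpow (-(a : ℂ)) (by simp))
    (analyticAt_one_sub_cpow (-(b : ℂ)) (by simp)) n
  -- Cesàro numbers are the binomial coefficients of `(1 - z) ^ (-a)`, so convolving them multiplies
  -- powers of `1 - z`.
  have h2 : taylorCoeff n (fun z : ℂ => (1 - z) ^ (-(a : ℂ)) * (1 - z) ^ (-(b : ℂ))) =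
      taylorCoeff n (fun z : ℂ => (1 - z) ^ (-((a + b : ℝ) : ℂ))) := by
    refine taylorCoeff_congr (one_sub_eventually fun z hz => ?_) n
    rw [← Complex.cpow_add _ _ (Complex.slitPlane_ne_zero (one_sub_mem_slitPlane hz))]
    push_cast
    ring_nf
  rw [h2, taylorCoeff_one_sub_cpow] at h
  simp only [taylorCoeff_one_sub_cpow] at h
  exact_mod_cast h.symm

/-! ### The Caputo difference as an implicit scheme -/

lemma caputo_eq_sum (α : ℝ) {h : ℝ} (hh : 0 < h) (v : ℕ → ℝ) (n : ℕ) :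
    caputo α h v n =
      h ^ (-α) * ∑ i ∈ Finset.range n, cesaro (1 - α) (n - 1 - i) * (v (i + 1) - v i) := by
  have e : h ^ (1 - α) = h ^ (-α) * h := by
    rw [← Real.rpow_add_one hh.ne']
    ring_nf
  have e2 : ∑ j ∈ Finset.Icc 1 n, cesaro (1 - α) (n - j) * backDiff h v j =
      ∑ i ∈ Finset.range n, cesaro (1 - α) (n - 1 - i) * backDiff h v (i + 1) := by
    rw [Finset.range_eq_Ico, ← Finset.Ico_add_one_right_eq_Icc, ← Finset.sum_Ico_add' _ 0 n 1]
    refine Finset.sum_congr rfl fun i _ => ?_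
    rw [show n - (i + 1) = n - 1 - i by omega]
  rw [caputo, fracSum, e, mul_assoc, e2, Finset.mul_sum]
  congr 1
  refine Finset.sum_congr rfl fun i _ => ?_
  rw [backDiff, Nat.add_sub_cancel]
  field_simp

/-- Weights of the past values in the implicit scheme equivalent to the Caputo difference. -/
def histWeight (α : ℝ) (n j : ℕ) : ℝ :=
  if j = 0 then cesaro (1 - α) (n - 1) else cesaro (1 - α) (n - 1 - j) - cesaro (1 - α) (n - j)

lemma histWeight_nonneg {α : ℝ} (h0 : 0 ≤ α) (h1 : α ≤ 1) {n j : ℕ} (hj : j < n) :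
    0 ≤ histWeight α n j := by
  unfold histWeight
  split_ifs with h
  · exact cesaro_nonneg (by linarith) _
  · have := cesaro_succ_le (a := 1 - α) (by linarith) (by linarith) (n - 1 - j)
    rw [show n - 1 - j + 1 = n - j by omega] at this
    linarith

/-- Summation by parts. The last value has coefficient `cesaro (1 - α) 0 = 1`, and the boundary term
at `0` is the special branch of `histWeight`. -/
lemma sum_cesaro_mul_diff (α : ℝ) (v : ℕ → ℝ) {n : ℕ} (hn : 1 ≤ n) :
    ∑ i ∈ Finset.range n, cesaro (1 - α) (n - 1 - i) * (v (i + 1) - v i) =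
      v n - ∑ j ∈ Finset.range n, histWeight α n j * v j := by
  obtain ⟨m, rfl⟩ : ∃ m, n = m + 1 := ⟨n - 1, by omega⟩
  simp only [mul_sub, Finset.sum_sub_distrib]
  rw [Finset.sum_range_succ, Finset.sum_range_succ' (fun i => cesaro (1 - α) (m + 1 - 1 - i) * v i),
    Finset.sum_range_succ' (fun j => histWeight α (m + 1) j * v j)]
  have e : ∀ i ∈ Finset.range m, histWeight α (m + 1) (i + 1) * v (i + 1) =
      cesaro (1 - α) (m + 1 - 1 - (i + 1)) * v (i + 1) -
        cesaro (1 - α) (m + 1 - 1 - i) * v (i + 1) := by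
    intro i hi
    simp only [histWeight, Nat.add_eq_zero_iff, one_ne_zero, and_false, if_false]
    rw [show m + 1 - (i + 1) = m + 1 - 1 - i by omega]
    ring
  rw [Finset.sum_congr rfl e, Finset.sum_sub_distrib]
  simp [histWeight]
  ring

lemma caputo_eq (α : ℝ) {h : ℝ} (hh : 0 < h) (v : ℕ → ℝ) {n : ℕ} (hn : 1 ≤ n) :
    caputo α h v n = h ^ (-α) * (v n - ∑ j ∈ Finset.range n, histWeight α n j * v j) := by
  rw [caputo_eq_sum α hh, sum_cesaro_mul_diff α v hn]

/-- Solutions of the implicit scheme starting from `1` with rate `κ` decay like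
`1 / (1 + κ n^α)`. -/
theorem implicit_scheme_le {α : ℝ} (h0 : 0 ≤ α) (h1 : α ≤ 1) {κ : ℝ} (hκ : 0 ≤ κ) {s : ℕ → ℝ}
    (hs0 : s 0 = 1)
    (hs : ∀ n, 1 ≤ n → (1 + κ) * s n = ∑ j ∈ Finset.range n, histWeight α n j * s j)
    (n : ℕ) (hn : 1 ≤ n) : s n ≤ 1 / (1 + κ * (n : ℝ) ^ α) := by
  have hpos : ∀ n, 0 ≤ s n := by
    intro n
    induction n using Nat.strong_induction_on with
    | _ n ih =>
      rcases Nat.eq_zero_or_pos n with rfl | hn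
      · simp [hs0]
      · have : 0 ≤ (1 + κ) * s n := by
          rw [hs n hn]
          exact Finset.sum_nonneg fun j hj =>
            mul_nonneg (histWeight_nonneg h0 h1 (Finset.mem_range.mp hj))
              (ih j (Finset.mem_range.mp hj))
        exact nonneg_of_mul_nonneg_right this (by linarith)
  set d : ℕ → ℝ := fun i => s i - s (i + 1) with hd
  -- The scheme undone by parts: the fractional difference of `s` equals `-κ s`, with `d` the
  -- decrements.
  have hconv : ∀ m, ∑ i ∈ Finset.range (m + 1), cesaro (1 - α) (m - i) * d i = κ * s (m + 1) := by
    intro m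
    have := sum_cesaro_mul_diff α s (Nat.le_add_left 1 m)
    rw [← hs (m + 1) (Nat.le_add_left 1 m)] at this
    have e : ∑ i ∈ Finset.range (m + 1), cesaro (1 - α) (m - i) * d i =
        -∑ i ∈ Finset.range (m + 1), cesaro (1 - α) (m + 1 - 1 - i) * (s (i + 1) - s i) := by
      rw [← Finset.sum_neg_distrib]
      exact Finset.sum_congr rfl fun i _ => by simp only [hd, Nat.add_sub_cancel]; ring
    rw [e, this]
    ring
  -- Subtracting `hconv` at consecutive indices expresses the new decrement through the earlier
  -- ones, with nonnegative weights since the kernel decreases.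
  have hdpos : ∀ m, 0 ≤ d m := by
    intro m
    induction m using Nat.strong_induction_on with
    | _ m ih =>
      rcases Nat.eq_zero_or_pos m with rfl | hm
      · have := hconv 0
        simp only [zero_add, Finset.range_one, Finset.sum_singleton, Nat.sub_self,
          cesaro_zero_right, one_mul] at this
        rw [this]
        exact mul_nonneg hκ (hpos 1)
      · obtain ⟨k, rfl⟩ : ∃ k, m = k + 1 := ⟨m - 1, by omega⟩
        have ha := hconv (k + 1)
        have hb := hconv k
        rw [Finset.sum_range_succ] at ha
        have hc : (1 + κ) * d (k + 1) = ∑ i ∈ Finset.range (k + 1),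
            (cesaro (1 - α) (k - i) - cesaro (1 - α) (k + 1 - i)) * d i := by
          simp only [sub_mul, Finset.sum_sub_distrib, hb]
          have : d (k + 1) = s (k + 1) - s (k + 1 + 1) := rfl
          simp only [Nat.sub_self, cesaro_zero_right, one_mul] at ha
          linear_combination ha + κ * this
        have : 0 ≤ (1 + κ) * d (k + 1) := by
          rw [hc]
          refine Finset.sum_nonneg fun i hi => mul_nonneg ?_ (ih i (Finset.mem_range.mp hi))
          have hi' := Finset.mem_range.mp hi
          have := cesaro_succ_le (a := 1 - α) (by linarith) (by linarith) (k - i)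
          rw [show k - i + 1 = k + 1 - i by omega] at this
          linarith
        exact nonneg_of_mul_nonneg_right this (by linarith)
  have hanti : Antitone s := antitone_nat_of_succ_le fun m => by
    have := hdpos m
    simp only [hd] at this
    linarith
  obtain ⟨m, rfl⟩ : ∃ m, n = m + 1 := ⟨n - 1, by omega⟩
  -- Discrete fractional integration: convolving `hconv` with the kernel of order `α` produces the
  -- kernel of order `1`, which is constant, and the decrements telescope.
  have hinv : 1 - s (m + 1) =
      κ * ∑ i ∈ Finset.range (m + 1), cesaro α (m - i) * s (i + 1) := by
    have e1 : κ * ∑ i ∈ Finset.range (m + 1), cesaro α (m - i) * s (i + 1) =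
        ∑ i ∈ Finset.range (m + 1), ∑ j ∈ Finset.range (i + 1),
          cesaro α (m - i) * (cesaro (1 - α) (i - j) * d j) := by
      rw [Finset.mul_sum]
      refine Finset.sum_congr rfl fun i _ => ?_
      rw [← Finset.mul_sum, hconv i]
      ring
    have e2 : ∑ i ∈ Finset.range (m + 1), ∑ j ∈ Finset.range (i + 1),
          cesaro α (m - i) * (cesaro (1 - α) (i - j) * d j) =
        ∑ j ∈ Finset.range (m + 1), ∑ l ∈ Finset.range (m - j + 1),
          cesaro (1 - α) l * cesaro α (m - j - l) * d j := by
      rw [Finset.sum_sigma', Finset.sum_sigma']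
      refine Finset.sum_bij' (fun x _ => ⟨x.2, x.1 - x.2⟩) (fun y _ => ⟨y.1 + y.2, y.1⟩)
        ?_ ?_ ?_ ?_ ?_
      · rintro ⟨i, j⟩ hx
        simp only [Finset.mem_sigma, Finset.mem_range] at hx ⊢
        omega
      · rintro ⟨i, j⟩ hx
        simp only [Finset.mem_sigma, Finset.mem_range] at hx ⊢
        omega
      · rintro ⟨i, j⟩ hx
        simp only [Finset.mem_sigma, Finset.mem_range] at hx
        simp only [Sigma.mk.injEq, heq_eq_eq, and_true]
        omega
      · rintro ⟨i, j⟩ hx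
        simp
      · rintro ⟨i, j⟩ hx
        simp only [Finset.mem_sigma, Finset.mem_range] at hx
        dsimp only
        rw [show m - j - (i - j) = m - i by omega]
        ring
    rw [e1, e2]
    have e3 : ∀ j ∈ Finset.range (m + 1), ∑ l ∈ Finset.range (m - j + 1),
          cesaro (1 - α) l * cesaro α (m - j - l) * d j = s j - s (j + 1) := by
      intro j _
      rw [← Finset.sum_mul, sum_cesaro_mul_cesaro, show 1 - α + α = 1 by ring, cesaro_one, one_mul]
    rw [Finset.sum_congr rfl e3, Finset.sum_range_sub', hs0]
  -- Each value of `s` is bounded below by the last one; the remaining weights add up to the Cesàro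
  -- number of order `α + 1`.
  have hlow : s (m + 1) * cesaro (α + 1) m ≤
      ∑ i ∈ Finset.range (m + 1), cesaro α (m - i) * s (i + 1) := by
    rw [show α + 1 = 1 + α by ring, ← sum_cesaro_mul_cesaro, Finset.mul_sum]
    refine Finset.sum_le_sum fun i hi => ?_
    rw [cesaro_one, one_mul, mul_comm]
    refine mul_le_mul_of_nonneg_left (hanti ?_) (cesaro_nonneg h0 _)
    have := Finset.mem_range.mp hi
    omega
  have hr := rpow_le_cesaro h0 h1 m
  rw [le_div_iff₀ (by positivity)]
  push_cast
  have h2 : s (m + 1) * (κ * ((m : ℝ) + 1) ^ α) ≤ κ * (s (m + 1) * cesaro (α + 1) m) := by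
    have := mul_le_mul_of_nonneg_left hr (mul_nonneg hκ (hpos (m + 1)))
    linarith
  have h3 := mul_le_mul_of_nonneg_left hlow hκ
  linarith

/-! ### The Wright coefficients -/

lemma div_cpow_ofReal {h : ℝ} (hh : 0 < h) (a : ℝ) {w : ℂ} (hw : w ≠ 0) :
    (w / (h : ℂ)) ^ (a : ℂ) = ((h ^ (-a) : ℝ) : ℂ) * w ^ (a : ℂ) := by
  have hi : 0 < h⁻¹ := inv_pos.mpr hh
  rw [show w / (h : ℂ) = ((h⁻¹ : ℝ) : ℂ) * w by push_cast; field_simp, Complex.cpow_def_of_ne_zero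
    (mul_ne_zero (by exact_mod_cast hi.ne') hw), Complex.log_ofReal_mul hi hw, add_mul,
    Complex.exp_add, Complex.cpow_def_of_ne_zero hw]
  congr 1
  rw [Real.rpow_def_of_pos hh, Real.log_inv]
  push_cast
  ring_nf

/-- The function whose Taylor coefficients are the Wright coefficients. -/
def wrightGen (α β h : ℝ) (j : ℕ) (z : ℂ) : ℂ :=
  (1 - (h : ℂ) * ((1 - z) / (h : ℂ)) ^ (α : ℂ)) ^ j / ((1 - z) / (h : ℂ)) ^ (β : ℂ)

lemma one_sub_div_mem_slitPlane {h : ℝ} (hh : 0 < h) {z : ℂ} (hz : ‖z‖ < 1) :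
    (1 - z) / (h : ℂ) ∈ Complex.slitPlane := by
  left
  have := (Complex.abs_re_le_norm z).trans_lt hz
  rw [Complex.div_ofReal_re]
  refine div_pos ?_ hh
  simp only [Complex.sub_re, Complex.one_re]
  linarith [(abs_lt.mp this).2]

lemma analyticAt_one_sub_div_cpow (a : ℂ) {h : ℝ} (hh : 0 < h) {z : ℂ} (hz : ‖z‖ < 1) :
    AnalyticAt ℂ (fun z : ℂ => ((1 - z) / (h : ℂ)) ^ a) z :=
  ((analyticAt_const.sub analyticAt_id).div analyticAt_const
    (by exact_mod_cast hh.ne')).cpow analyticAt_const (one_sub_div_mem_slitPlane hh hz)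

lemma one_sub_div_cpow_ne_zero (a : ℂ) {h : ℝ} (hh : 0 < h) {z : ℂ} (hz : ‖z‖ < 1) :
    ((1 - z) / (h : ℂ)) ^ a ≠ 0 := by
  rw [Complex.cpow_def_of_ne_zero (Complex.slitPlane_ne_zero (one_sub_div_mem_slitPlane hh hz))]
  exact Complex.exp_ne_zero _

lemma analyticAt_wrightGen (α β : ℝ) {h : ℝ} (hh : 0 < h) (j : ℕ) {z : ℂ} (hz : ‖z‖ < 1) :
    AnalyticAt ℂ (wrightGen α β h j) z :=
  ((analyticAt_const.sub (analyticAt_const.mul (analyticAt_one_sub_div_cpow _ hh hz))).pow j).div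
    (analyticAt_one_sub_div_cpow _ hh hz) (one_sub_div_cpow_ne_zero _ hh hz)

lemma diffContOnCl_wrightGen (α β : ℝ) {h : ℝ} (hh : 0 < h) (j : ℕ) {r : ℝ} (hr1 : r < 1) :
    DiffContOnCl ℂ (wrightGen α β h j) (Metric.ball 0 r) := by
  refine DifferentiableOn.diffContOnCl fun z hz => ?_
  have hz' := Metric.closure_ball_subset_closedBall hz
  rw [mem_closedBall_zero_iff] at hz'
  exact (analyticAt_wrightGen α β hh j
    (hz'.trans_lt hr1)).differentiableAt.differentiableWithinAt

/-- Cauchy's formula on a circle inside the disc of holomorphy. The coefficients need not be shown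
real: later identities are linear in them with real coefficients, so they pass to real parts. -/
lemma wright_eq_re_taylorCoeff (α β : ℝ) {h : ℝ} (hh : 0 < h) (n j : ℕ) :
    wright α β h n j = (taylorCoeff n (wrightGen α β h j)).re := by
  have := (diffContOnCl_wrightGen α β hh j (r := 1 / 2)
    (by norm_num)).circleIntegral_one_div_sub_center_pow_smul (by norm_num) n
  have e : ∮ z in C(0, 1 / 2), (z ^ (n + 1))⁻¹ * ((1 - (h : ℂ) * ((1 - z) / (h : ℂ)) ^ (α : ℂ)) ^ j /
      ((1 - z) / (h : ℂ)) ^ (β : ℂ)) =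
      ∮ z in C(0, 1 / 2), (1 / (z - 0) ^ (n + 1)) • wrightGen α β h j z := by
    simp only [sub_zero, one_div, smul_eq_mul, wrightGen]
  rw [wright, e, this, taylorCoeff, smul_eq_mul]
  congr 1
  have hpi : (2 * (Real.pi : ℂ) * Complex.I) ≠ 0 := Complex.two_pi_I_ne_zero
  field_simp

/-- The base of the `j`-th power equals `1 - h ^ (1 - α)` at the origin, of modulus less than one
precisely under `h2`. By continuity it stays below some `q < 1` on a small circle, where Cauchy's
estimate yields `q ^ j`. -/
lemma exists_wright_bound {α β h : ℝ} (hh : 0 < h) (h2 : h ^ (1 - α) < 2) :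
    ∃ q : ℝ, 0 ≤ q ∧ q < 1 ∧ ∀ n : ℕ, ∃ C : ℝ, ∀ j : ℕ, |wright α β h n j| ≤ C * q ^ j := by
  set B : ℂ → ℂ := fun z => 1 - (h : ℂ) * ((1 - z) / (h : ℂ)) ^ (α : ℂ) with hB
  have hBan : ∀ z : ℂ, ‖z‖ < 1 → AnalyticAt ℂ B z := fun z hz =>
    analyticAt_const.sub (analyticAt_const.mul (analyticAt_one_sub_div_cpow _ hh hz))
  have hB0 : ‖B 0‖ < 1 := by
    have e : B 0 = ((1 - h ^ (1 - α) : ℝ) : ℂ) := by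
      simp only [hB, sub_zero]
      rw [div_cpow_ofReal hh α one_ne_zero, Complex.one_cpow, mul_one, sub_eq_add_neg (1 : ℝ) α,
        Real.rpow_add hh, Real.rpow_one]
      push_cast
      ring
    rw [e, Complex.norm_real, Real.norm_eq_abs, abs_lt]
    constructor <;> linarith [Real.rpow_pos_of_pos hh (1 - α)]
  obtain ⟨q, hq0, hq1⟩ := exists_between hB0
  have hev : ∀ᶠ z in 𝓝 (0 : ℂ), ‖B z‖ < q :=
    (hBan 0 (by simp)).continuousAt.norm.eventually_lt continuousAt_const hq0
  obtain ⟨ρ, hρ, hball⟩ := Metric.eventually_nhds_iff.mp hev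
  set r := min (ρ / 2) (1 / 2) with hr
  have hr0 : 0 < r := by positivity
  have hr1 : r < 1 := (min_le_right _ _).trans_lt (by norm_num)
  have hrρ : r < ρ := (min_le_left _ _).trans_lt (by linarith)
  have hDc : ContinuousOn (fun z : ℂ => (((1 - z) / (h : ℂ)) ^ (β : ℂ))⁻¹) (Metric.sphere 0 r) := by
    intro z hz
    have hz1 : ‖z‖ < 1 := by rw [mem_sphere_zero_iff_norm.mp hz]; exact hr1
    exact ((analyticAt_one_sub_div_cpow _ hh hz1).continuousAt.inv₀
      (one_sub_div_cpow_ne_zero _ hh hz1)).continuousWithinAt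
  obtain ⟨M, hM⟩ := (isCompact_sphere (0 : ℂ) r).exists_bound_of_continuousOn hDc
  refine ⟨q, (norm_nonneg _).trans hq0.le, hq1, fun n => ⟨M / r ^ n, fun j => ?_⟩⟩
  rw [wright_eq_re_taylorCoeff α β hh]
  refine (Complex.abs_re_le_norm _).trans ?_
  have hbd := Complex.norm_iteratedDeriv_le_of_forall_mem_sphere_norm_le (C := M * q ^ j) n hr0
    (diffContOnCl_wrightGen α β hh j hr1) (fun z hz => by
      have hz1 : ‖B z‖ ≤ q := (hball (by
        rw [dist_zero_right, mem_sphere_zero_iff_norm.mp hz]; exact hrρ)).le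
      rw [wrightGen, div_eq_mul_inv, norm_mul, norm_pow, mul_comm]
      exact mul_le_mul (hM z hz) (pow_le_pow_left₀ (norm_nonneg _) hz1 j) (by positivity)
        ((norm_nonneg _).trans (hM z hz)))
  rw [taylorCoeff, norm_div, Complex.norm_natCast, div_le_iff₀ (by positivity)]
  refine hbd.trans_eq ?_
  ring

lemma taylorCoeff_one_sub (n : ℕ) : taylorCoeff n (fun z : ℂ => 1 - z) =
    if n = 0 then 1 else if n = 1 then -1 else 0 := by
  rw [taylorCoeff_sub (F := fun _ => 1) (G := fun z => z) analyticAt_const analyticAt_id,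
    taylorCoeff, taylorCoeff,
    iteratedDeriv_fun_id_zero, iteratedDeriv_const]
  rcases n with _ | _ | n <;> simp

lemma taylorCoeff_one_sub_mul_zero {F : ℂ → ℂ} (hF : AnalyticAt ℂ F 0) :
    taylorCoeff 0 (fun z => (1 - z) * F z) = taylorCoeff 0 F := by
  rw [taylorCoeff_mul (F := fun z => 1 - z) (analyticAt_const.sub analyticAt_id) hF]
  simp [taylorCoeff_one_sub]

/-- Multiplication by `1 - z` is the backward difference on coefficients. -/
lemma taylorCoeff_one_sub_mul_succ {F : ℂ → ℂ} (hF : AnalyticAt ℂ F 0) (n : ℕ) :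
    taylorCoeff (n + 1) (fun z => (1 - z) * F z) = taylorCoeff (n + 1) F - taylorCoeff n F := by
  rw [taylorCoeff_mul (F := fun z => 1 - z) (analyticAt_const.sub analyticAt_id) hF,
    Finset.sum_range_succ',
    Finset.sum_range_succ']
  simp [taylorCoeff_one_sub]
  ring

/-- Partial sums of the subordination series solve the scalar Caputo equation up to an error. -/
theorem caputo_wright_partial {α h κ : ℝ} (hh : 0 < h) (hκ : 0 ≤ κ) (J n : ℕ) (hn : 1 ≤ n) :
    caputo α h (fun m => if m = 0 then 1 else
        ∑ j ∈ Finset.range J, wright α (1 - α) h (m - 1) j * ((1 + h * κ)⁻¹) ^ (j + 1)) n =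
      -κ * (∑ j ∈ Finset.range J, wright α (1 - α) h (n - 1) j * ((1 + h * κ)⁻¹) ^ (j + 1)) -
        h⁻¹ * ((1 + h * κ)⁻¹) ^ J * wright α (1 - α) h (n - 1) J := by
  obtain ⟨m, rfl⟩ : ∃ m, n = m + 1 := ⟨n - 1, by omega⟩
  set x : ℝ := (1 + h * κ)⁻¹ with hx
  set F : ℂ → ℂ := fun z => ∑ j ∈ Finset.range J, ((x ^ (j + 1) : ℝ) : ℂ) * wrightGen α (1 - α) h j z
    with hF
  have hgen : ∀ j, AnalyticAt ℂ (wrightGen α (1 - α) h j) 0 :=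
    fun j => analyticAt_wrightGen α (1 - α) hh j (by simp)
  have hFan : AnalyticAt ℂ F 0 :=
    Finset.analyticAt_fun_sum _ fun j _ => analyticAt_const.mul (hgen j)
  have hV : ∀ i, ∑ j ∈ Finset.range J, wright α (1 - α) h i j * x ^ (j + 1) =
      (taylorCoeff i F).re := by
    intro i
    rw [hF, taylorCoeff_sum (F := fun j z => ((x ^ (j + 1) : ℝ) : ℂ) * wrightGen α (1 - α) h j z) _
      fun j _ => analyticAt_const.mul (hgen j), Complex.re_sum]
    refine Finset.sum_congr rfl fun j _ => ?_
    rw [taylorCoeff_const_mul, Complex.re_ofReal_mul, wright_eq_re_taylorCoeff _ _ hh, mul_comm]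
  set Q : ℂ → ℂ := fun z => (1 - z) * F z with hQ
  have hQan : AnalyticAt ℂ Q 0 := (analyticAt_const.sub analyticAt_id).mul hFan
  set A : ℂ → ℂ := fun z => (1 - z) ^ (-((1 - α : ℝ) : ℂ)) with hA
  have hAan : AnalyticAt ℂ A 0 := analyticAt_one_sub_cpow _ (by simp)
  -- The values at steps `1, 2, …` are the coefficients `0, 1, …` of `F`, so their differences are
  -- the coefficients of `Q`; the initial value `1` enters only through the subtracted Cesàro
  -- number.
  have hsum : ∑ i ∈ Finset.range (m + 1), cesaro (1 - α) (m - i) *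
      ((if i + 1 = 0 then 1 else
        ∑ j ∈ Finset.range J, wright α (1 - α) h (i + 1 - 1) j * x ^ (j + 1)) -
       (if i = 0 then 1 else
        ∑ j ∈ Finset.range J, wright α (1 - α) h (i - 1) j * x ^ (j + 1))) =
      (taylorCoeff m (fun z => Q z * A z)).re - cesaro (1 - α) m := by
    rw [taylorCoeff_mul hQan hAan, Complex.re_sum, Finset.sum_range_succ',
      Finset.sum_range_succ' (fun i => (taylorCoeff i Q * taylorCoeff (m - i) A).re)]
    have e0 : (taylorCoeff 0 Q * taylorCoeff m A).re =
        cesaro (1 - α) m * (taylorCoeff 0 F).re := by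
      rw [hQ, taylorCoeff_one_sub_mul_zero hFan, hA, taylorCoeff_one_sub_cpow,
        Complex.re_mul_ofReal, mul_comm]
    have e1 : ∀ i, (taylorCoeff (i + 1) Q * taylorCoeff (m - (i + 1)) A).re =
        cesaro (1 - α) (m - (i + 1)) * ((taylorCoeff (i + 1) F).re - (taylorCoeff i F).re) := by
      intro i
      rw [hQ, taylorCoeff_one_sub_mul_succ hFan, hA, taylorCoeff_one_sub_cpow,
        Complex.re_mul_ofReal, mul_comm, Complex.sub_re]
    simp only [Nat.sub_zero, e0, e1, hV, Nat.add_sub_cancel, Nat.add_eq_zero_iff, one_ne_zero, and_false,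
      if_false, if_true]
    ring
  -- `E` is the symbol of the Caputo difference, and `F` is a geometric sum of ratio `x (1 - h E)`.
  -- Since `1 - x (1 - h E) = x h (κ + E)`, multiplying `F` by `κ + E` telescopes it, leaving the
  -- source term and the term of index `J`.
  have hpt : (fun z => ((h ^ (-α) : ℝ) : ℂ) * (Q z * A z - A z)) =ᶠ[𝓝 0]
      fun z => ((-κ : ℝ) : ℂ) * F z - ((h⁻¹ * x ^ J : ℝ) : ℂ) * wrightGen α (1 - α) h J z := by
    refine one_sub_eventually fun z hz => ?_
    have hw : (1 - z) ≠ 0 := Complex.slitPlane_ne_zero (one_sub_mem_slitPlane hz)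
    set E : ℂ := ((1 - z) / (h : ℂ)) ^ (α : ℂ) with hE
    set D : ℂ := (((1 - z) / (h : ℂ)) ^ ((1 - α : ℝ) : ℂ))⁻¹ with hD
    have hEA : ((h ^ (-α) : ℝ) : ℂ) * ((1 - z) * A z) = E := by
      rw [hE, div_cpow_ofReal hh α hw, hA]
      congr 1
      dsimp only
      nth_rewrite 1 [← Complex.cpow_one (1 - z)]
      rw [← Complex.cpow_add _ _ hw]
      congr 1
      push_cast
      ring
    have hDA : ((h ^ (-α) : ℝ) : ℂ) * A z = (h : ℂ)⁻¹ * D := by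
      rw [hD, div_cpow_ofReal hh (1 - α) hw, mul_inv, hA]
      dsimp only
      rw [Complex.cpow_neg, ← mul_assoc]
      congr 1
      rw [← Complex.ofReal_inv, ← Complex.ofReal_inv, ← Complex.ofReal_mul, neg_sub,
        ← Real.rpow_neg hh.le, Complex.ofReal_inj, ← Real.rpow_neg_one, ← Real.rpow_add hh]
      ring_nf
    have hgenz : ∀ j, wrightGen α (1 - α) h j z = (1 - (h : ℂ) * E) ^ j * D := fun j => by
      rw [wrightGen, div_eq_mul_inv]
    have hxC : ((x : ℝ) : ℂ) * (1 + h * κ) = 1 := by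
      have : x * (1 + h * κ) = 1 := inv_mul_cancel₀ (by positivity)
      exact_mod_cast this
    have hgeo := mul_neg_geom_sum ((x : ℂ) * (1 - (h : ℂ) * E)) J
    have hFz : F z = (x : ℂ) * D * ∑ j ∈ Finset.range J, ((x : ℂ) * (1 - (h : ℂ) * E)) ^ j := by
      rw [hF, Finset.mul_sum]
      refine Finset.sum_congr rfl fun j _ => ?_
      rw [hgenz, mul_pow]
      push_cast
      ring
    have hh' : (h : ℂ) ≠ 0 := by exact_mod_cast hh.ne'
    set S := ∑ j ∈ Finset.range J, ((x : ℂ) * (1 - (h : ℂ) * E)) ^ j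
    have hl : ((h ^ (-α) : ℝ) : ℂ) * (Q z * A z - A z) = E * F z - (h : ℂ)⁻¹ * D := by
      rw [← hEA, ← hDA, hQ]
      ring
    dsimp only
    rw [hl, hgenz, hFz]
    push_cast
    rw [mul_pow] at hgeo
    have hinv : (h : ℂ)⁻¹ * h = 1 := inv_mul_cancel₀ hh'
    linear_combination ((h : ℂ)⁻¹ * D) * hgeo - (D * S * x * E + D * S * x * κ) * hinv +
      ((h : ℂ)⁻¹ * D * S) * hxC
  have hT := taylorCoeff_congr hpt m
  rw [taylorCoeff_const_mul, taylorCoeff_sub (F := fun z => Q z * A z) (hQan.mul hAan) hAan,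
    taylorCoeff_sub (F := fun z => ((-κ : ℝ) : ℂ) * F z)
      (G := fun z => ((h⁻¹ * x ^ J : ℝ) : ℂ) * wrightGen α (1 - α) h J z)
      (analyticAt_const.mul hFan) (analyticAt_const.mul (hgen J)),
    taylorCoeff_const_mul, taylorCoeff_const_mul, hA, taylorCoeff_one_sub_cpow] at hT
  have hTre := congrArg Complex.re hT
  rw [Complex.re_ofReal_mul, Complex.sub_re, Complex.ofReal_re, Complex.sub_re,
    Complex.re_ofReal_mul, Complex.re_ofReal_mul, ← wright_eq_re_taylorCoeff _ _ hh] at hTre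
  rw [caputo_eq_sum α hh]
  simp only [Nat.add_sub_cancel] at hsum ⊢
  rw [hsum, hV]
  exact hTre

/-! ### Fourier transforms and distributional Poisson equations -/

section Fourier

open scoped FourierTransform SchwartzMap
open Laplacian

/-- The Fourier transform of a real-valued function on `ℝ^N`. -/
def ft {N : ℕ} (v : Sp N → ℝ) (ξ : Sp N) : ℂ := 𝓕 (fun x => (v x : ℂ)) ξ

/-- The symbol `4π²|ξ|²` of the negative Laplacian. -/
def symb {N : ℕ} (ξ : Sp N) : ℝ := 4 * Real.pi ^ 2 * ‖ξ‖ ^ 2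

lemma symb_nonneg {N : ℕ} (ξ : Sp N) : 0 ≤ symb ξ := by unfold symb; positivity

lemma symb_neg {N : ℕ} (ξ : Sp N) : symb (-ξ) = symb ξ := by simp [symb]

lemma fourier_laplacian {N : ℕ} (f : 𝓢(Sp N, ℂ)) (ξ : Sp N) :
    𝓕 (Δ f) ξ = -(symb ξ : ℂ) * 𝓕 f ξ := by
  rw [SchwartzMap.laplacian_eq_fourierMultiplierCLM, SchwartzMap.fourierMultiplierCLM_apply]
  have hg : (fun x : Sp N => ‖x‖ ^ 2).HasTemperateGrowth := by fun_prop
  rw [FourierTransform.fourier_smul, FourierTransform.fourier_fourierInv_eq]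
  rw [smul_apply, SchwartzMap.smulLeftCLM_apply_apply hg]
  simp [symb]
  ring

lemma two_le_smooth : ((2 : ℕ) : WithTop ℕ∞) ≤ (∞ : WithTop ℕ∞) := by
  exact WithTop.coe_le_coe.mpr (le_top : (2 : ℕ∞) ≤ ⊤)

lemma laplacian_comp_const_sub {N : ℕ} {ψ : Sp N → ℝ} (hψ : ContDiff ℝ ∞ ψ) (y t : Sp N) :
    Δ (fun x => ψ (y - x)) t = Δ ψ (y - t) := by
  rw [InnerProductSpace.laplacian_eq_iteratedFDeriv_stdOrthonormalBasis,
    InnerProductSpace.laplacian_eq_iteratedFDeriv_stdOrthonormalBasis]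
  have h1 : (fun x => ψ (y - x)) = (fun z => ψ (y + z)) ∘ (-ContinuousLinearMap.id ℝ (Sp N)) := by
    ext x; simp [sub_eq_add_neg]
  have h2 : ContDiff ℝ ∞ (fun z => ψ (y + z)) := hψ.comp (contDiff_const.add contDiff_id)
  refine Finset.sum_congr rfl fun i _ => ?_
  rw [h1, ContinuousLinearMap.iteratedFDeriv_comp_right _ h2 _ two_le_smooth]
  rw [ContinuousMultilinearMap.compContinuousLinearMap_apply, iteratedFDeriv_comp_add_left']
  simp only [sub_eq_add_neg]
  have := (iteratedFDeriv ℝ 2 ψ (y + -t)).map_smul_univ (fun _ => (-1 : ℝ))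
    ![stdOrthonormalBasis ℝ (Sp N) i, stdOrthonormalBasis ℝ (Sp N) i]
  simp only [Fin.prod_univ_two, mul_neg, mul_one, neg_neg, one_smul] at this
  rw [← this]
  congr 1
  ext j
  fin_cases j <;> simp

lemma laplacian_ofReal {N : ℕ} {φ : Sp N → ℝ} (hφ : ContDiff ℝ ∞ φ) (x : Sp N) :
    Δ (fun x => (φ x : ℂ)) x = ((Δ φ x : ℝ) : ℂ) := by
  have := (hφ.contDiffAt (x := x)).of_le two_le_smooth
    |>.laplacian_CLM_comp_left (l := Complex.ofRealCLM)
  simpa [Function.comp_def] using this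

/-- A real test function as a complex Schwartz function. -/
def testSchwartz {N : ℕ} (φ : Sp N → ℝ) (hφ : ContDiff ℝ ∞ φ) (hs : HasCompactSupport φ) :
    𝓢(Sp N, ℂ) :=
  HasCompactSupport.toSchwartzMap (f := fun x => (φ x : ℂ))
    (hs.comp_left (g := fun r : ℝ => (r : ℂ)) (by simp)) (Complex.ofRealCLM.contDiff.comp hφ)

@[simp] lemma testSchwartz_apply {N : ℕ} (φ : Sp N → ℝ) (hφ : ContDiff ℝ ∞ φ)
    (hs : HasCompactSupport φ) (x : Sp N) : testSchwartz φ hφ hs x = (φ x : ℂ) := rfl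

lemma laplacian_testSchwartz {N : ℕ} (φ : Sp N → ℝ) (hφ : ContDiff ℝ ∞ φ)
    (hs : HasCompactSupport φ) (x : Sp N) :
    (Δ (testSchwartz φ hφ hs)) x = ((Δ φ x : ℝ) : ℂ) := by
  rw [SchwartzMap.laplacian_apply]
  exact laplacian_ofReal hφ x

/-- The multiplication formula applied to `Φ = 𝓕 (𝓕⁻ Φ)`; it asks of `v` only integrability. -/
lemma integral_mul_schwartz {N : ℕ} {v : Sp N → ℝ} (hv : Integrable v) (Φ : 𝓢(Sp N, ℂ)) :
    ∫ x, (v x : ℂ) * Φ x = ∫ ξ, ft v ξ * 𝓕⁻ Φ ξ := by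
  have h := VectorFourier.integral_fourierIntegral_smul_eq_flip (L := innerₗ (Sp N))
    (μ := volume) (ν := volume) (f := fun x => (v x : ℂ)) (g := (𝓕⁻ Φ : 𝓢(Sp N, ℂ)))
    Real.continuous_fourierChar continuous_inner hv.ofReal (SchwartzMap.integrable _)
  rw [flip_innerₗ] at h
  simp only [smul_eq_mul] at h
  refine Eq.trans ?_ h.symm
  refine integral_congr_ae (Eventually.of_forall fun x => ?_)
  dsimp only
  congr 1
  have : 𝓕 (𝓕⁻ Φ) = Φ := FourierTransform.fourier_fourierInv_eq Φ
  conv_lhs => rw [← this]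
  rfl

lemma fourierInv_laplacian {N : ℕ} (f : 𝓢(Sp N, ℂ)) (ξ : Sp N) :
    𝓕⁻ (Δ f) ξ = -(symb ξ : ℂ) * 𝓕⁻ f ξ := by
  rw [SchwartzMap.fourierInv_apply_eq, SchwartzMap.fourierInv_apply_eq]
  simpa [symb_neg] using fourier_laplacian f (-ξ)

lemma norm_ft_le {N : ℕ} (v : Sp N → ℝ) (ξ : Sp N) : ‖ft v ξ‖ ≤ ∫ x, ‖v x‖ := by
  refine (VectorFourier.norm_fourierIntegral_le_integral_norm Real.fourierChar volume
    (innerₗ (Sp N)) (fun x => (v x : ℂ)) ξ).trans_eq ?_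
  simp

lemma ft_eq_integral {N : ℕ} (v : Sp N → ℝ) (ξ : Sp N) :
    ft v ξ = ∫ x, Complex.exp ((-2 * Real.pi * inner ℝ x ξ : ℝ) * Complex.I) * (v x : ℂ) := by
  rw [ft, Real.fourier_eq']
  rfl

lemma re_ft {N : ℕ} {v : Sp N → ℝ} (hv : Integrable v) (ξ : Sp N) :
    (ft v ξ).re = ∫ x, Real.cos (2 * Real.pi * inner ℝ x ξ) * v x := by
  have hi : Integrable fun x =>
      Complex.exp ((-2 * Real.pi * inner ℝ x ξ : ℝ) * Complex.I) * (v x : ℂ) := by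
    refine hv.ofReal.bdd_mul (c := 1) ?_ (Eventually.of_forall fun x => ?_)
    · exact Continuous.aestronglyMeasurable (by fun_prop)
    · rw [Complex.norm_exp_ofReal_mul_I]
  rw [ft_eq_integral]
  refine (integral_re (𝕜 := ℂ) hi).symm.trans ?_
  refine integral_congr_ae (Eventually.of_forall fun x => ?_)
  dsimp only
  rw [RCLike.re_eq_complex_re, Complex.re_mul_ofReal, Complex.exp_ofReal_mul_I_re,
    show -2 * Real.pi * inner ℝ x ξ = -(2 * Real.pi * inner ℝ x ξ) by ring, Real.cos_neg]

lemma continuous_ft {N : ℕ} {v : Sp N → ℝ} (hv : Integrable v) : Continuous (ft v) :=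
  VectorFourier.fourierIntegral_continuous Real.continuous_fourierChar continuous_inner hv.ofReal

/-- An identity between Fourier transforms gives a distributional Poisson equation. -/
theorem weak_of_ft {N : ℕ} {v g : Sp N → ℝ} (hv : Integrable v) (hg : Integrable g) (c : ℝ)
    (h : ∀ ξ, -(symb ξ : ℂ) * ft v ξ = ft g ξ + c) (φ : Sp N → ℝ) (hφ : ContDiff ℝ ∞ φ)
    (hs : HasCompactSupport φ) :
    ∫ x, v x * Δ φ x = (∫ x, g x * φ x) + c * φ 0 := by
  set Φ := testSchwartz φ hφ hs
  have h1 := integral_mul_schwartz hv (Δ Φ)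
  have h2 := integral_mul_schwartz hg Φ
  have e1 : ((∫ x, v x * Δ φ x : ℝ) : ℂ) = ∫ ξ, ft v ξ * 𝓕⁻ (Δ Φ) ξ := by
    rw [← h1, ← integral_complex_ofReal]
    simp only [Φ, laplacian_testSchwartz, Complex.ofReal_mul]
  have e2 : ((∫ x, g x * φ x : ℝ) : ℂ) = ∫ ξ, ft g ξ * 𝓕⁻ Φ ξ := by
    rw [← h2, ← integral_complex_ofReal]
    simp only [Φ, testSchwartz_apply, Complex.ofReal_mul]
  -- Fourier inversion at the origin: the Dirac mass has constant transform `1`.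
  have e3 : ((φ 0 : ℝ) : ℂ) = ∫ ξ, 𝓕⁻ Φ ξ := by
    have : 𝓕 (𝓕⁻ Φ) 0 = Φ 0 := by rw [FourierTransform.fourier_fourierInv_eq Φ]
    rw [show ((φ 0 : ℝ) : ℂ) = Φ 0 from rfl, ← this, SchwartzMap.fourier_coe, Real.fourier_eq]
    simp
  have hi : Integrable fun ξ => ft g ξ * 𝓕⁻ Φ ξ :=
    (SchwartzMap.integrable (𝓕⁻ Φ)).bdd_mul (continuous_ft hg).aestronglyMeasurable
      (Eventually.of_forall (norm_ft_le g))
  apply Complex.ofReal_injective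
  rw [Complex.ofReal_add, Complex.ofReal_mul, e1, e2, e3, ← integral_const_mul,
    ← integral_add hi ((SchwartzMap.integrable (𝓕⁻ Φ)).const_mul _)]
  refine integral_congr_ae (Eventually.of_forall fun ξ => ?_)
  simp only [fourierInv_laplacian]
  linear_combination (𝓕⁻ Φ ξ) * h ξ

/-- Integrable functions with the same Fourier transform agree almost everywhere. -/
theorem ae_eq_of_ft_eq {N : ℕ} {v w : Sp N → ℝ} (hv : Integrable v) (hw : Integrable w)
    (h : ∀ ξ, ft v ξ = ft w ξ) : v =ᵐ[volume] w := by
  refine ae_eq_of_integral_contDiff_smul_eq hv.locallyIntegrable hw.locallyIntegrable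
    fun φ hφ hs => ?_
  have h1 := integral_mul_schwartz hv (testSchwartz φ hφ hs)
  have h2 := integral_mul_schwartz hw (testSchwartz φ hφ hs)
  simp only [h] at h1
  rw [← h2] at h1
  simp only [testSchwartz_apply, ← Complex.ofReal_mul] at h1
  rw [integral_complex_ofReal, integral_complex_ofReal, Complex.ofReal_inj] at h1
  simpa only [smul_eq_mul, mul_comm] using h1

/-- A nonnegative bump supported where `cos (2π x·ξ)` is positive has a transform with positive real
part at `ξ`. It is the factor to be divided out in `ft_of_weak`. -/
lemma exists_bump_fourier_ne_zero {N : ℕ} (ξ : Sp N) :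
    ∃ (ψ : Sp N → ℝ), ContDiff ℝ ∞ ψ ∧ HasCompactSupport ψ ∧ ft ψ ξ ≠ 0 := by
  have hcont : Continuous fun x : Sp N => Real.cos (2 * Real.pi * inner ℝ x ξ) := by fun_prop
  obtain ⟨r, hr, hball⟩ := Metric.isOpen_iff.mp (isOpen_lt continuous_const hcont) 0
    (show (0 : ℝ) < _ by simp)
  let ψ : ContDiffBump (0 : Sp N) := ⟨r / 2, r, by positivity, by linarith⟩
  refine ⟨ψ, ψ.contDiff, ψ.hasCompactSupport, fun h0 => ?_⟩
  have hre := re_ft (ψ.continuous.integrable_of_hasCompactSupport ψ.hasCompactSupport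
    : Integrable ψ) ξ
  have hpos : 0 < ∫ x, Real.cos (2 * Real.pi * inner ℝ x ξ) * ψ x := by
    refine (hcont.mul ψ.continuous).integral_pos_of_hasCompactSupport_nonneg_nonzero
      ψ.hasCompactSupport.mul_left (fun x => ?_) (x := 0) ?_
    · by_cases hx : x ∈ Metric.ball (0 : Sp N) r
      · exact mul_nonneg (hball hx).le ψ.nonneg
      · simp only [Pi.zero_apply]
        rw [ψ.zero_of_le_dist (by simpa [Metric.mem_ball] using hx), mul_zero]
    · have := ψ.one_of_mem_closedBall (x := 0) (by simp [ψ.rIn_pos.le])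
      simp [this]
  rw [← hre, h0] at hpos
  simp at hpos

/-- A distributional Poisson equation gives an identity between Fourier transforms. -/
theorem ft_of_weak {N : ℕ} {v g : Sp N → ℝ} (hv : Integrable v) (hg : Integrable g) (c : ℝ)
    (h : ∀ φ : Sp N → ℝ, ContDiff ℝ ∞ φ → HasCompactSupport φ →
      ∫ x, v x * Δ φ x = (∫ x, g x * φ x) + c * φ 0) (ξ : Sp N) :
    -(symb ξ : ℂ) * ft v ξ = ft g ξ + c := by
  obtain ⟨ψ, hψ, hs, hne⟩ := exists_bump_fourier_ne_zero ξ
  set Ψ := testSchwartz ψ hψ hs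
  -- Testing with the reflected translates `ψ (y - ·)` turns the weak equation into a pointwise
  -- identity of convolutions, whose transform carries the nonzero factor `𝓕 Ψ ξ`.
  have hy : ∀ y, (convolution (fun x => (v x : ℂ)) (Δ Ψ : 𝓢(Sp N, ℂ))
      (ContinuousLinearMap.mul ℂ ℂ) volume) y = (convolution (fun x => (g x : ℂ)) Ψ
      (ContinuousLinearMap.mul ℂ ℂ) volume) y + c * Ψ y := by
    intro y
    have hd : ContDiff ℝ ∞ (fun x => ψ (y - x)) := hψ.comp (contDiff_const.sub contDiff_id)
    have hc : HasCompactSupport (fun x => ψ (y - x)) :=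
      hs.comp_homeomorph (Homeomorph.subLeft y)
    have := h _ hd hc
    simp only [laplacian_comp_const_sub hψ, sub_zero] at this
    simp only [convolution_def, ContinuousLinearMap.mul_apply', Ψ, laplacian_testSchwartz,
      testSchwartz_apply, ← Complex.ofReal_mul, integral_complex_ofReal]
    exact_mod_cast this
  have hft := congrArg (fun F : Sp N → ℂ => 𝓕 F ξ) (funext hy)
  have hcv : Integrable (convolution (fun x => (g x : ℂ)) Ψ (ContinuousLinearMap.mul ℂ ℂ) volume) :=
    hg.ofReal.integrable_convolution _ (SchwartzMap.integrable Ψ)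
  have hadd : 𝓕 (fun y => convolution (fun x => (g x : ℂ)) Ψ (ContinuousLinearMap.mul ℂ ℂ) volume y
      + c * Ψ y) ξ = 𝓕 (convolution (fun x => (g x : ℂ)) Ψ (ContinuousLinearMap.mul ℂ ℂ) volume) ξ
      + c * 𝓕 (Ψ : Sp N → ℂ) ξ := by
    have hI2 : Integrable (fun y => (c : ℂ) * Ψ y) := (SchwartzMap.integrable Ψ).const_mul _
    have e := congrFun (VectorFourier.fourierIntegral_add (L := innerₗ (Sp N)) (μ := volume)
      Real.continuous_fourierChar continuous_inner hcv hI2) ξ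
    have e2 := congrFun (VectorFourier.fourierIntegral_const_smul Real.fourierChar volume
      (innerₗ (Sp N)) (Ψ : Sp N → ℂ) (c : ℂ)) ξ
    refine e.trans ?_
    exact congrArg₂ (· + ·) rfl e2
  have c1 : 𝓕 (convolution (fun x => (v x : ℂ)) (Δ Ψ : 𝓢(Sp N, ℂ))
      (ContinuousLinearMap.mul ℂ ℂ) volume) ξ = ft v ξ * 𝓕 (Δ Ψ) ξ :=
    Real.fourier_mul_convolution_eq hv.ofReal (SchwartzMap.integrable _) ξ
  have c2 : 𝓕 (convolution (fun x => (g x : ℂ)) Ψ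
      (ContinuousLinearMap.mul ℂ ℂ) volume) ξ = ft g ξ * 𝓕 Ψ ξ :=
    Real.fourier_mul_convolution_eq hg.ofReal (SchwartzMap.integrable _) ξ
  rw [hadd, c1, c2, fourier_laplacian, ← SchwartzMap.fourier_coe] at hft
  have hne' : 𝓕 Ψ ξ ≠ 0 := hne
  apply mul_right_cancel₀ hne'
  linear_combination hft

/-! ### The equation on the Fourier side -/

/-- The target is a general normed space so as to cover both real test functions and complex
characters. -/
lemma integral_comb_smul {N : ℕ} {F : Type*} [NormedAddCommGroup F] [NormedSpace ℝ F]
    {a : ℕ → Sp N → ℝ} {b : Sp N → F} {n : ℕ} (r : ℝ) (w : ℕ → ℝ)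
    (hi : ∀ j, j ≤ n → Integrable fun x => a j x • b x) :
    ∫ x, (r * (a n x - ∑ j ∈ Finset.range n, w j * a j x)) • b x =
      r • ((∫ x, a n x • b x) - ∑ j ∈ Finset.range n, w j • ∫ x, a j x • b x) := by
  have hs : ∀ j ∈ Finset.range n, Integrable fun x => w j • (a j x • b x) := fun j hj =>
    (hi j (Finset.mem_range.mp hj).le).smul (w j)
  have e : ∀ x, (r * (a n x - ∑ j ∈ Finset.range n, w j * a j x)) • b x =
      r • (a n x • b x - ∑ j ∈ Finset.range n, w j • (a j x • b x)) := by
    intro x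
    simp only [mul_smul, sub_smul, Finset.sum_smul]
  simp only [e]
  rw [integral_smul, integral_sub (hi n le_rfl) (integrable_finsetSum _ hs),
    integral_finsetSum _ hs]
  simp only [integral_smul]

lemma ft_eq_integral_smul {N : ℕ} (v : Sp N → ℝ) (ξ : Sp N) :
    ft v ξ = ∫ x, v x • Complex.exp ((-2 * Real.pi * inner ℝ x ξ : ℝ) * Complex.I) := by
  rw [ft_eq_integral]
  simp only [Complex.real_smul, mul_comm]

lemma integrable_smul_char {N : ℕ} {v : Sp N → ℝ} (hv : Integrable v) (ξ : Sp N) :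
    Integrable fun x => v x • Complex.exp ((-2 * Real.pi * inner ℝ x ξ : ℝ) * Complex.I) := by
  refine hv.smul_bdd 1 ?_ (Eventually.of_forall fun x => ?_)
  · exact Continuous.aestronglyMeasurable (by fun_prop)
  · rw [Complex.norm_exp_ofReal_mul_I]

lemma integrable_mul_test {N : ℕ} {v φ : Sp N → ℝ} (hv : Integrable v) (hφ : Continuous φ)
    (hs : HasCompactSupport φ) : Integrable fun x => v x • φ x := by
  obtain ⟨C, hC⟩ := hφ.bounded_above_of_compact_support hs
  exact hv.smul_bdd C hφ.aestronglyMeasurable (Eventually.of_forall hC)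

/-- Fourier form of one step of the implicit scheme, with a Dirac mass of weight `c`. -/
lemma weak_step_iff {N : ℕ} {a : ℕ → Sp N → ℝ} (n : ℕ) (ha : ∀ j, j ≤ n → Integrable (a j))
    {r : ℝ} (w : ℕ → ℝ) (c : ℝ) :
    (∀ φ : Sp N → ℝ, ContDiff ℝ ∞ φ → HasCompactSupport φ →
      ∫ x, a n x * Δ φ x = r * ((∫ x, a n x * φ x) -
        ∑ j ∈ Finset.range n, w j * ∫ x, a j x * φ x) + c * φ 0) ↔
    ∀ ξ, -(symb ξ : ℂ) * ft (a n) ξ =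
      r * (ft (a n) ξ - ∑ j ∈ Finset.range n, w j * ft (a j) ξ) + c := by
  set g : Sp N → ℝ := fun x => r * (a n x - ∑ j ∈ Finset.range n, w j * a j x) with hg
  have hgi : Integrable g := ((ha n le_rfl).sub (integrable_finsetSum _ fun j hj =>
    (ha j (Finset.mem_range.mp hj).le).const_mul _)).const_mul r
  have h1 : ∀ φ : Sp N → ℝ, ContDiff ℝ ∞ φ → HasCompactSupport φ →
      r * ((∫ x, a n x * φ x) - ∑ j ∈ Finset.range n, w j * ∫ x, a j x * φ x) =
        ∫ x, g x * φ x := fun φ hφ hs =>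
    (integral_comb_smul (b := φ) r w fun j hj =>
      integrable_mul_test (ha j hj) hφ.continuous hs).symm
  have h2 : ∀ ξ, (r : ℂ) * (ft (a n) ξ - ∑ j ∈ Finset.range n, w j * ft (a j) ξ) = ft g ξ := by
    intro ξ
    have := integral_comb_smul r w fun j hj => integrable_smul_char (ha j hj) ξ
    rw [ft_eq_integral_smul g]
    refine Eq.trans ?_ this.symm
    simp only [ft_eq_integral_smul, Complex.real_smul]
  constructor
  · intro h ξ
    rw [h2]
    exact ft_of_weak (ha n le_rfl) hgi c (fun φ hφ hs => by rw [h φ hφ hs, h1 φ hφ hs]) ξ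
  · intro h φ hφ hs
    rw [h1 φ hφ hs]
    exact weak_of_ft (ha n le_rfl) hgi c (fun ξ => by rw [h ξ, h2]) φ hφ hs

lemma rpow_cancel {h : ℝ} (hh : 0 < h) (α : ℝ) : ((h ^ α : ℝ) : ℂ) * ((h ^ (-α) : ℝ) : ℂ) = 1 := by
  rw [← Complex.ofReal_mul, ← Real.rpow_add hh]
  simp

/-- Fourier form of the equation for the fundamental solution. -/
theorem isFundamentalSolution_iff {N : ℕ} {α h : ℝ} (hh : 0 < h) {K : ℕ → Sp N → ℝ}
    (hK : ∀ n, 1 ≤ n → Integrable (K n)) :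
    IsFundamentalSolution α h K ↔ ∀ n, 1 ≤ n → ∀ ξ,
      (1 + (h ^ α : ℝ) * symb ξ : ℂ) * ft (K n) ξ =
        ∑ j ∈ Finset.range n, (histWeight α n j : ℂ) * (if j = 0 then 1 else ft (K j) ξ) := by
  have hz : ft (fun _ : Sp N => (0 : ℝ)) = 0 := by
    ext ξ; simp [ft_eq_integral]
  have key : ∀ n, 1 ≤ n → ((∀ φ : Sp N → ℝ, ContDiff ℝ ∞ φ → HasCompactSupport φ →
      caputo α h (fun m => if m = 0 then φ 0 else ∫ x, K m x * φ x) n = ∫ x, K n x * Δ φ x) ↔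
      ∀ ξ, (1 + (h ^ α : ℝ) * symb ξ : ℂ) * ft (K n) ξ =
        ∑ j ∈ Finset.range n, (histWeight α n j : ℂ) * (if j = 0 then 1 else ft (K j) ξ)) := by
    intro n hn
    have hn0 : n ≠ 0 := by omega
    have hsplit : ∀ {R : Type} [CommRing R] (w V : ℕ → R) (d : R),
        ∑ j ∈ Finset.range n, w j * (if j = 0 then d else V j) =
          (∑ j ∈ Finset.range n, w j * (if j = 0 then 0 else V j)) + w 0 * d := by
      intro R _ w V d
      obtain ⟨m, rfl⟩ : ∃ m, n = m + 1 := ⟨n - 1, by omega⟩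
      simp [Finset.sum_range_succ']
    -- The Dirac mass is not a function: the slot `0` is filled with zero, and the initial datum is
    -- carried by the constant `-(h ^ (-α) * histWeight α n 0)`.
    set a : ℕ → Sp N → ℝ := fun j => if j = 0 then fun _ => 0 else K j with ha
    have han : a n = K n := by simp [ha, hn0]
    have hai : ∀ j, j ≤ n → Integrable (a j) := by
      intro j _
      by_cases hj : j = 0
      · simp [ha, hj]
      · simpa [ha, hj] using hK j (by omega)
    have step := weak_step_iff n hai (r := h ^ (-α)) (fun j => histWeight α n j)
      (-(h ^ (-α) * histWeight α n 0))
    rw [han] at step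
    have hl : ∀ φ : Sp N → ℝ, caputo α h (fun m => if m = 0 then φ 0 else ∫ x, K m x * φ x) n =
        h ^ (-α) * ((∫ x, K n x * φ x) -
        ∑ j ∈ Finset.range n, histWeight α n j * ∫ x, a j x * φ x) +
          -(h ^ (-α) * histWeight α n 0) * φ 0 := by
      intro φ
      rw [caputo_eq α hh _ hn, hsplit, if_neg hn0]
      have : ∀ j, (∫ x, a j x * φ x) = if j = 0 then 0 else ∫ x, K j x * φ x := by
        intro j
        by_cases hj : j = 0 <;> simp [ha, hj]
      simp only [this]
      ring
    have hr : ∀ ξ, (-(symb ξ : ℂ) * ft (K n) ξ =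
      (h ^ (-α) : ℝ) * (ft (K n) ξ - ∑ j ∈ Finset.range n, (histWeight α n j : ℂ) * ft (a j) ξ) +
        (-(h ^ (-α) * histWeight α n 0) : ℝ)) ↔ (1 + (h ^ α : ℝ) * symb ξ : ℂ) * ft (K n) ξ =
        ∑ j ∈ Finset.range n, (histWeight α n j : ℂ) * (if j = 0 then 1 else ft (K j) ξ) := by
      intro ξ
      have e : ∀ j, ft (a j) ξ = if j = 0 then 0 else ft (K j) ξ := by
        intro j
        by_cases hj : j = 0
        · simp [ha, hj, hz]
        · simp [ha, hj]
      have hc := rpow_cancel hh α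
      rw [hsplit]
      simp only [e]
      set S := ∑ j ∈ Finset.range n, (histWeight α n j : ℂ) * (if j = 0 then 0 else ft (K j) ξ)
      push_cast
      constructor
      · intro H
        linear_combination (-((h ^ α : ℝ) : ℂ)) * H -
          (ft (K n) ξ - S - (histWeight α n 0 : ℂ)) * hc
      · intro H
        linear_combination (-((h ^ (-α) : ℝ) : ℂ)) * H + (symb ξ * ft (K n) ξ) * hc
    rw [← forall_congr' hr, ← step]
    refine forall_congr' fun φ => forall_congr' fun _ => forall_congr' fun _ => ?_
    rw [hl, eq_comm]
  constructor
  · intro H n hn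
    exact (key n hn).mp (H.equation n hn)
  · intro H
    exact ⟨hK, fun n hn => (key n hn).mpr (H n hn)⟩

/-- Fourier form of the equation for solutions. -/
theorem isSolution_iff {N : ℕ} {α h : ℝ} (hh : 0 < h) {f : Sp N → ℝ} {u : ℕ → Sp N → ℝ}
    (hu : ∀ n, Integrable (u n)) (h0 : u 0 =ᵐ[volume] f) :
    IsSolution α h f u ↔ ∀ n, 1 ≤ n → ∀ ξ,
      (1 + (h ^ α : ℝ) * symb ξ : ℂ) * ft (u n) ξ =
        ∑ j ∈ Finset.range n, (histWeight α n j : ℂ) * ft (u j) ξ := by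
  have key : ∀ n, 1 ≤ n → (HasWeakLaplacian (u n) (fun x => caputo α h (fun m => u m x) n) ↔
      ∀ ξ, (1 + (h ^ α : ℝ) * symb ξ : ℂ) * ft (u n) ξ =
        ∑ j ∈ Finset.range n, (histWeight α n j : ℂ) * ft (u j) ξ) := by
    intro n hn
    have step := weak_step_iff n (fun j _ => hu j) (r := h ^ (-α)) (fun j => histWeight α n j) 0
    have hr : ∀ ξ, (-(symb ξ : ℂ) * ft (u n) ξ =
      (h ^ (-α) : ℝ) * (ft (u n) ξ - ∑ j ∈ Finset.range n, (histWeight α n j : ℂ) * ft (u j) ξ) +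
        (0 : ℝ)) ↔ (1 + (h ^ α : ℝ) * symb ξ : ℂ) * ft (u n) ξ =
        ∑ j ∈ Finset.range n, (histWeight α n j : ℂ) * ft (u j) ξ := by
      intro ξ
      have hc := rpow_cancel hh α
      set S := ∑ j ∈ Finset.range n, (histWeight α n j : ℂ) * ft (u j) ξ
      push_cast
      constructor
      · intro H
        linear_combination (-((h ^ α : ℝ) : ℂ)) * H - (ft (u n) ξ - S) * hc
      · intro H
        linear_combination (-((h ^ (-α) : ℝ) : ℂ)) * H + (symb ξ * ft (u n) ξ) * hc
    rw [← forall_congr' hr, ← step]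
    refine forall_congr' fun φ => forall_congr' fun hφ => forall_congr' fun hs => ?_
    have := integral_comb_smul (b := φ) (h ^ (-α)) (fun j => histWeight α n j) fun j (_ : j ≤ n) =>
      integrable_mul_test (hu j) hφ.continuous hs
    simp only [smul_eq_mul] at this
    simp only [caputo_eq α hh _ hn]
    rw [this]
    simp
  constructor
  · intro H n hn
    exact (key n hn).mp (H.equation n hn)
  · intro H
    exact ⟨hu, h0, fun n hn => (key n hn).mpr (H n hn)⟩

/-! ### Uniqueness, and solutions as convolutions with the fundamental solution. -/

lemma one_add_symb_ne_zero {N : ℕ} {h : ℝ} (hh : 0 < h) (α : ℝ) (ξ : Sp N) :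
    (1 + (h ^ α : ℝ) * symb ξ : ℂ) ≠ 0 := by
  have h1 := symb_nonneg ξ
  have h2 := Real.rpow_pos_of_pos hh α
  have : (1 + h ^ α * symb ξ : ℝ) ≠ 0 := by positivity
  exact_mod_cast this

lemma ft_congr {N : ℕ} {v w : Sp N → ℝ} (h : v =ᵐ[volume] w) : ft v = ft w := by
  ext ξ
  rw [ft_eq_integral, ft_eq_integral]
  refine integral_congr_ae ?_
  filter_upwards [h] with x hx
  rw [hx]

/-- Both transforms obey the same linear recursion in `n`, started from `ft f ξ` and from `1`, and
each step is determined by the previous ones. -/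
theorem ft_solution {N : ℕ} {α h : ℝ} (hh : 0 < h) {f : Sp N → ℝ} {u K : ℕ → Sp N → ℝ}
    (hu : IsSolution α h f u) (hK : IsFundamentalSolution α h K) (n : ℕ) (hn : 1 ≤ n) (ξ : Sp N) :
    ft (u n) ξ = ft (K n) ξ * ft f ξ := by
  have hK' := (isFundamentalSolution_iff hh hK.integrable).mp hK
  have hu' := (isSolution_iff hh hu.integrable hu.initial).mp hu
  have main : ∀ n, ft (u n) ξ = (if n = 0 then 1 else ft (K n) ξ) * ft f ξ := by
    intro n
    induction n using Nat.strong_induction_on with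
    | _ n ih =>
      rcases Nat.eq_zero_or_pos n with rfl | hn
      · simp [ft_congr hu.initial]
      · rw [if_neg hn.ne']
        apply mul_left_cancel₀ (one_add_symb_ne_zero hh α ξ)
        rw [hu' n hn ξ, ← mul_assoc, hK' n hn ξ, Finset.sum_mul]
        refine Finset.sum_congr rfl fun j hj => ?_
        rw [ih j (Finset.mem_range.mp hj)]
        ring
  rw [main n, if_neg (by omega)]

theorem fundamentalSolution_unique {N : ℕ} {α h : ℝ} (hh : 0 < h) {K K' : ℕ → Sp N → ℝ}
    (hK : IsFundamentalSolution α h K) (hK' : IsFundamentalSolution α h K') (n : ℕ) (hn : 1 ≤ n) :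
    K' n =ᵐ[volume] K n := by
  have h1 := (isFundamentalSolution_iff hh hK.integrable).mp hK
  have h2 := (isFundamentalSolution_iff hh hK'.integrable).mp hK'
  refine ae_eq_of_ft_eq (hK'.integrable n hn) (hK.integrable n hn) fun ξ => ?_
  have main : ∀ n, 1 ≤ n → ft (K' n) ξ = ft (K n) ξ := by
    intro n
    induction n using Nat.strong_induction_on with
    | _ n ih =>
      intro hn
      apply mul_left_cancel₀ (one_add_symb_ne_zero hh α ξ)
      rw [h1 n hn ξ, h2 n hn ξ]
      refine Finset.sum_congr rfl fun j hj => ?_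
      split_ifs with h0
      · rfl
      · rw [ih j (Finset.mem_range.mp hj) (by omega)]
  exact main n hn

lemma conv_eq_convolution {N : ℕ} (v f : Sp N → ℝ) :
    (fun x => ∫ y, v (x - y) * f y) =
      convolution f v (ContinuousLinearMap.mul ℝ ℝ) volume := by
  ext x
  simp only [convolution_def, ContinuousLinearMap.mul_apply', mul_comm]

lemma integrable_conv {N : ℕ} {v f : Sp N → ℝ} (hv : Integrable v) (hf : Integrable f) :
    Integrable fun x => ∫ y, v (x - y) * f y := by
  rw [conv_eq_convolution]
  exact hf.integrable_convolution _ hv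

lemma ft_conv {N : ℕ} {v f : Sp N → ℝ} (hv : Integrable v) (hf : Integrable f) (ξ : Sp N) :
    ft (fun x => ∫ y, v (x - y) * f y) ξ = ft v ξ * ft f ξ := by
  have c1 : 𝓕 (convolution (fun x => (f x : ℂ)) (fun x => (v x : ℂ))
      (ContinuousLinearMap.mul ℂ ℂ) volume) ξ = ft f ξ * ft v ξ :=
    Real.fourier_mul_convolution_eq hf.ofReal hv.ofReal ξ
  rw [mul_comm, ← c1, ft]
  refine congrArg (fun F : Sp N → ℂ => 𝓕 F ξ) (funext fun x => ?_)
  simp only [convolution_def, ContinuousLinearMap.mul_apply', ← Complex.ofReal_mul,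
    integral_complex_ofReal, mul_comm]

theorem solution_eq_conv {N : ℕ} {α h : ℝ} (hh : 0 < h) {f : Sp N → ℝ} (hf : Integrable f)
    {u K : ℕ → Sp N → ℝ} (hu : IsSolution α h f u) (hK : IsFundamentalSolution α h K) (n : ℕ)
    (hn : 1 ≤ n) : u n =ᵐ[volume] fun x => ∫ y, K n (x - y) * f y :=
  ae_eq_of_ft_eq (hu.integrable n) (integrable_conv (hK.integrable n hn) hf) fun ξ => by
    rw [ft_solution hh hu hK n hn, ft_conv (hK.integrable n hn) hf]

theorem exists_solution {N : ℕ} {α h : ℝ} (hh : 0 < h) {f : Sp N → ℝ} (hf : Integrable f)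
    {K : ℕ → Sp N → ℝ} (hK : IsFundamentalSolution α h K) :
    ∃ u : ℕ → Sp N → ℝ, IsSolution α h f u := by
  have h1 := (isFundamentalSolution_iff hh hK.integrable).mp hK
  set u : ℕ → Sp N → ℝ := fun n => if n = 0 then f else fun x => ∫ y, K n (x - y) * f y with hu
  have hui : ∀ n, Integrable (u n) := by
    intro n
    by_cases hn : n = 0
    · simpa [hu, hn] using hf
    · simpa [hu, hn] using integrable_conv (hK.integrable n (by omega)) hf
  have hft : ∀ n ξ, ft (u n) ξ = (if n = 0 then 1 else ft (K n) ξ) * ft f ξ := by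
    intro n ξ
    by_cases hn : n = 0
    · simp [hu, hn]
    · simp only [hu, hn, if_false]
      exact ft_conv (hK.integrable n (by omega)) hf ξ
  refine ⟨u, (isSolution_iff hh hui (by simp [hu])).mpr fun n hn ξ => ?_⟩
  simp only [hft]
  rw [if_neg (by omega), ← mul_assoc, h1 n hn ξ, Finset.sum_mul]
  exact Finset.sum_congr rfl fun j _ => by ring

end Fourier

/-! ### Mixtures of Gaussian kernels -/

lemma gaussKernel_nonneg {N : ℕ} {t : ℝ} (ht : 0 < t) (x : Sp N) : 0 ≤ gaussKernel t x := by
  unfold gaussKernel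
  positivity

lemma measurable_gaussKernel {N : ℕ} : Measurable fun q : Sp N × ℝ => gaussKernel q.2 q.1 := by
  unfold gaussKernel
  fun_prop

lemma continuous_gaussKernel {N : ℕ} (t : ℝ) : Continuous (gaussKernel (N := N) t) := by
  unfold gaussKernel
  fun_prop

lemma integral_exp_neg_norm_sq_div {N : ℕ} {t : ℝ} (ht : 0 < t) :
    ∫ x : Sp N, Real.exp (-(‖x‖ ^ 2 / (4 * t))) = (4 * Real.pi * t) ^ ((N : ℝ) / 2) := by
  have h := GaussianFourier.integral_rexp_neg_mul_sq_norm (V := Sp N) (b := 1 / (4 * t))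
    (by positivity)
  rw [finrank_euclideanSpace, Fintype.card_fin] at h
  rw [show Real.pi / (1 / (4 * t)) = 4 * Real.pi * t by field_simp] at h
  rw [← h]
  congr 1
  ext x
  ring_nf

lemma integrable_exp_neg_norm_sq_div {N : ℕ} {t : ℝ} (ht : 0 < t) :
    Integrable fun x : Sp N => Real.exp (-(‖x‖ ^ 2 / (4 * t))) := by
  -- A nonintegrable function has Bochner integral `0` by convention, whereas the Gaussian integral
  -- is positive.
  by_contra h
  have h1 := integral_exp_neg_norm_sq_div (N := N) ht
  rw [integral_undef h] at h1
  have : 0 < (4 * Real.pi * t) ^ ((N : ℝ) / 2) := by positivity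
  linarith

lemma integrable_gaussKernel {N : ℕ} {t : ℝ} (ht : 0 < t) :
    Integrable (gaussKernel (N := N) t) :=
  (integrable_exp_neg_norm_sq_div ht).const_mul _

lemma integral_gaussKernel {N : ℕ} {t : ℝ} (ht : 0 < t) :
    ∫ x : Sp N, gaussKernel t x = 1 := by
  unfold gaussKernel
  rw [integral_const_mul, integral_exp_neg_norm_sq_div ht, ← Real.rpow_add (by positivity)]
  simp

lemma ft_gaussKernel {N : ℕ} {t : ℝ} (ht : 0 < t) (ξ : Sp N) :
    ft (gaussKernel t) ξ = (Real.exp (-(symb ξ * t)) : ℂ) := by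
  have hb : 0 < ((1 / (4 * t) : ℝ) : ℂ).re := by rw [Complex.ofReal_re]; positivity
  have h := fourier_gaussian_innerProductSpace (V := Sp N) hb ξ
  rw [finrank_euclideanSpace, Fintype.card_fin, Real.fourier_eq'] at h
  have hp : (0 : ℝ) < 4 * Real.pi * t := by positivity
  have e1 : ((Real.pi : ℂ) / ((1 / (4 * t) : ℝ) : ℂ)) ^ ((N : ℂ) / 2) =
      (((4 * Real.pi * t) ^ ((N : ℝ) / 2) : ℝ) : ℂ) := by
    rw [Complex.ofReal_cpow hp.le]
    push_cast
    congr 1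
    have : (t : ℂ) ≠ 0 := by exact_mod_cast ht.ne'
    field_simp
  have e2 : Complex.exp (-(Real.pi : ℂ) ^ 2 * (‖ξ‖ : ℂ) ^ 2 / ((1 / (4 * t) : ℝ) : ℂ)) =
      (Real.exp (-(symb ξ * t)) : ℂ) := by
    rw [symb]
    push_cast
    congr 1
    have : (t : ℂ) ≠ 0 := by exact_mod_cast ht.ne'
    field_simp
  rw [e1, e2] at h
  rw [ft_eq_integral]
  have e3 : ∀ x : Sp N, Complex.exp ((-2 * Real.pi * inner ℝ x ξ : ℝ) * Complex.I) *
      (gaussKernel t x : ℂ) = (((4 * Real.pi * t) ^ (-((N : ℝ) / 2)) : ℝ) : ℂ) *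
      (Complex.exp ((-2 * Real.pi * inner ℝ x ξ : ℝ) * Complex.I) •
        Complex.exp (-((1 / (4 * t) : ℝ) : ℂ) * (‖x‖ : ℂ) ^ 2)) := by
    intro x
    have : (((Real.exp (-(‖x‖ ^ 2 / (4 * t)))) : ℝ) : ℂ) =
        Complex.exp (-((1 / (4 * t) : ℝ) : ℂ) * (‖x‖ : ℂ) ^ 2) := by
      push_cast
      congr 1
      ring
    rw [gaussKernel, Complex.ofReal_mul ((4 * Real.pi * t) ^ (-((N : ℝ) / 2))), this, smul_eq_mul]
    ring
  simp only [e3]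
  rw [integral_const_mul, h, ← mul_assoc, ← Complex.ofReal_mul, ← Real.rpow_add hp]
  simp

/-- The superposition `∫ G_t(x) dμ(t)` of Gaussian kernels. -/
def mix {N : ℕ} (μ : Measure ℝ) (x : Sp N) : ℝ := ∫ t, gaussKernel t x ∂μ

lemma integrable_gaussKernel_prod {N : ℕ} {μ : Measure ℝ} [IsFiniteMeasure μ]
    (hμ : ∀ᵐ t ∂μ, 0 < t) :
    Integrable (fun q : Sp N × ℝ => gaussKernel q.2 q.1) (volume.prod μ) := by
  rw [integrable_prod_iff' measurable_gaussKernel.aestronglyMeasurable]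
  refine ⟨hμ.mono fun t ht => integrable_gaussKernel ht, ?_⟩
  refine (integrable_const (1 : ℝ)).congr ?_
  filter_upwards [hμ] with t ht
  rw [← integral_gaussKernel (N := N) ht]
  exact integral_congr_ae (Eventually.of_forall fun x =>
    (Real.norm_of_nonneg (gaussKernel_nonneg ht x)).symm)

lemma integrable_mix {N : ℕ} {μ : Measure ℝ} [IsFiniteMeasure μ] (hμ : ∀ᵐ t ∂μ, 0 < t) :
    Integrable (mix (N := N) μ) :=
  (integrable_gaussKernel_prod hμ).integral_prod_left

/-- Fubini: the transform of a mixture is the Laplace transform of the mixing measure at `symb ξ`,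
so solving the equation is a question about Laplace transforms. -/
lemma ft_mix {N : ℕ} {μ : Measure ℝ} [IsFiniteMeasure μ] (hμ : ∀ᵐ t ∂μ, 0 < t) (ξ : Sp N) :
    ft (mix μ) ξ = ((∫ t, Real.exp (-(symb ξ * t)) ∂μ : ℝ) : ℂ) := by
  have hi : Integrable (fun q : Sp N × ℝ => gaussKernel q.2 q.1 •
      Complex.exp ((-2 * Real.pi * inner ℝ q.1 ξ : ℝ) * Complex.I)) (volume.prod μ) := by
    refine (integrable_gaussKernel_prod hμ).smul_bdd 1 ?_ (Eventually.of_forall fun q => ?_)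
    · exact Continuous.aestronglyMeasurable (by fun_prop)
    · rw [Complex.norm_exp_ofReal_mul_I]
  rw [ft_eq_integral_smul]
  simp only [mix, ← integral_smul_const]
  rw [integral_integral_swap hi, ← integral_complex_ofReal]
  refine integral_congr_ae ?_
  filter_upwards [hμ] with t ht
  rw [← ft_gaussKernel ht, ft_eq_integral_smul]

/-! ### Gamma distributions -/

/-- Density of the Gamma distribution with shape `i` and scale `h`. -/
def gammaDensity (h : ℝ) (i : ℕ) (t : ℝ) : ℝ :=
  (h ^ i * Real.Gamma (i : ℝ))⁻¹ * (Real.exp (-(t / h)) * t ^ (i - 1))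

/-- The Gamma distribution with shape `i` and scale `h`. -/
def gam (h : ℝ) (i : ℕ) : Measure ℝ :=
  (volume.restrict (Set.Ioi 0)).withDensity fun t => ENNReal.ofReal (gammaDensity h i t)

lemma measurable_gammaDensity (h : ℝ) (i : ℕ) : Measurable (gammaDensity h i) := by
  unfold gammaDensity
  fun_prop

lemma gammaDensity_nonneg {h : ℝ} (hh : 0 < h) (i : ℕ) {t : ℝ} (ht : 0 < t) :
    0 ≤ gammaDensity h i t := by
  have : 0 ≤ Real.Gamma (i : ℝ) := Real.Gamma_nonneg_of_nonneg (by positivity)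
  unfold gammaDensity
  positivity

lemma gam_pos (h : ℝ) (i : ℕ) : ∀ᵐ t ∂(gam h i), 0 < t :=
  (withDensity_absolutelyContinuous _ _).ae_le (ae_restrict_mem measurableSet_Ioi)

lemma integral_gam {h : ℝ} (hh : 0 < h) (i : ℕ) (g : ℝ → ℝ) :
    ∫ t, g t ∂(gam h i) = ∫ t in Set.Ioi (0 : ℝ), gammaDensity h i t * g t := by
  rw [gam, integral_withDensity_eq_integral_toReal_smul
    (measurable_gammaDensity h i).ennreal_ofReal
    (Eventually.of_forall fun _ => ENNReal.ofReal_lt_top)]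
  refine setIntegral_congr_fun measurableSet_Ioi fun t ht => ?_
  simp only [smul_eq_mul]
  rw [ENNReal.toReal_ofReal (gammaDensity_nonneg hh i ht)]

lemma integral_gammaDensity_mul_exp {h κ : ℝ} (hh : 0 < h) (hκ : 0 ≤ κ) {i : ℕ} (hi : 1 ≤ i) :
    ∫ t in Set.Ioi (0 : ℝ), gammaDensity h i t * Real.exp (-(κ * t)) = ((1 + h * κ)⁻¹) ^ i := by
  have hi' : (0 : ℝ) < i := by exact_mod_cast hi
  have hr : 0 < 1 / h + κ := by positivity
  have hG : 0 < Real.Gamma (i : ℝ) := Real.Gamma_pos_of_pos hi'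
  have h1 := Real.integral_rpow_mul_exp_neg_mul_Ioi hi' hr
  have e : ∀ t ∈ Set.Ioi (0 : ℝ), gammaDensity h i t * Real.exp (-(κ * t)) =
      (h ^ i * Real.Gamma (i : ℝ))⁻¹ * (t ^ ((i : ℝ) - 1) * Real.exp (-((1 / h + κ) * t))) := by
    intro t _
    have : t ^ ((i : ℝ) - 1) = t ^ (i - 1) := by
      rw [← Real.rpow_natCast, Nat.cast_sub hi, Nat.cast_one]
    rw [this, gammaDensity, show -((1 / h + κ) * t) = -(t / h) + -(κ * t) by ring, Real.exp_add]
    ring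
  rw [setIntegral_congr_fun measurableSet_Ioi e, integral_const_mul, h1, Real.rpow_natCast]
  rw [show 1 / (1 / h + κ) = h * (1 + h * κ)⁻¹ by field_simp, mul_pow]
  field_simp

lemma laplace_gam {h κ : ℝ} (hh : 0 < h) (hκ : 0 ≤ κ) {i : ℕ} (hi : 1 ≤ i) :
    ∫ t, Real.exp (-(κ * t)) ∂(gam h i) = ((1 + h * κ)⁻¹) ^ i := by
  rw [integral_gam hh, integral_gammaDensity_mul_exp hh hκ hi]

lemma isFiniteMeasure_gam {h : ℝ} (hh : 0 < h) {i : ℕ} (hi : 1 ≤ i) :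
    IsFiniteMeasure (gam h i) := by
  have h1 := integral_gammaDensity_mul_exp hh le_rfl hi
  simp only [zero_mul, neg_zero, Real.exp_zero, mul_one, mul_zero, add_zero, inv_one,
    one_pow] at h1
  have h2 : Integrable (gammaDensity h i) (volume.restrict (Set.Ioi 0)) := by
    by_contra h
    rw [integral_undef h] at h1
    exact zero_ne_one h1
  exact isFiniteMeasure_withDensity_ofReal h2.2

lemma discreteGauss_eq_mix {N : ℕ} {h : ℝ} (hh : 0 < h) (i : ℕ) :
    discreteGauss (N := N) h i = mix (gam h i) := by
  ext x
  rw [discreteGauss, mix, integral_gam hh, ← integral_const_mul]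
  refine setIntegral_congr_fun measurableSet_Ioi fun t _ => ?_
  simp only [gammaDensity]
  ring

/-! ### The fundamental solution as a mixture -/

/-- Probability that the implicit scheme started at step `n` reaches step `0` after exactly `i`
jumps. -/
def jumpProb (α : ℝ) : ℕ → ℕ → ℝ
  | 0, n => if n = 0 then 1 else 0
  | i + 1, n => ∑ j ∈ Finset.range n, histWeight α n j * jumpProb α i j

lemma jumpProb_nonneg {α : ℝ} (h0 : 0 ≤ α) (h1 : α ≤ 1) (i n : ℕ) : 0 ≤ jumpProb α i n := by
  induction i generalizing n with
  | zero => unfold jumpProb; split_ifs <;> simp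
  | succ i ih =>
    exact Finset.sum_nonneg fun j hj =>
      mul_nonneg (histWeight_nonneg h0 h1 (Finset.mem_range.mp hj)) (ih j)

lemma jumpProb_eq_zero (α : ℝ) {i n : ℕ} (h : n < i) : jumpProb α i n = 0 := by
  induction i generalizing n with
  | zero => omega
  | succ i ih =>
    refine Finset.sum_eq_zero fun j hj => ?_
    rw [ih (by have := Finset.mem_range.mp hj; omega), mul_zero]

/-- Generating function of the number of jumps. -/
def jumpGen (α x : ℝ) (n : ℕ) : ℝ := ∑ i ∈ Finset.range (n + 1), jumpProb α i n * x ^ i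

lemma jumpGen_zero (α x : ℝ) : jumpGen α x 0 = 1 := by simp [jumpGen, jumpProb]

lemma jumpGen_eq (α x : ℝ) {n : ℕ} (hn : 1 ≤ n) :
    jumpGen α x n = ∑ i ∈ Finset.range n, jumpProb α (i + 1) n * x ^ (i + 1) := by
  rw [jumpGen, Finset.sum_range_succ']
  have : n ≠ 0 := by omega
  simp [jumpProb, this]

/-- Conditioning on the first jump. At most `j` jumps are possible from step `j`, so all the inner
sums can be taken over the same range. -/
lemma jumpGen_rec (α x : ℝ) {n : ℕ} (hn : 1 ≤ n) :
    jumpGen α x n = x * ∑ j ∈ Finset.range n, histWeight α n j * jumpGen α x j := by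
  have e : ∀ j ∈ Finset.range n, jumpGen α x j = ∑ i ∈ Finset.range n, jumpProb α i j * x ^ i := by
    intro j hj
    refine Finset.sum_subset (Finset.range_mono (Finset.mem_range.mp hj)) fun i _ hi => ?_
    rw [jumpProb_eq_zero α (by simpa using hi), zero_mul]
  rw [jumpGen_eq α x hn, Finset.mul_sum]
  simp only [jumpProb, Finset.sum_mul]
  rw [Finset.sum_comm]
  refine Finset.sum_congr rfl fun j hj => ?_
  rw [e j hj, Finset.mul_sum, Finset.mul_sum]
  exact Finset.sum_congr rfl fun i _ => by ring

/-- The mixing measure of the fundamental solution at step `n`. -/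
def mixMeasure (α h : ℝ) (n : ℕ) : Measure ℝ :=
  ∑ i ∈ Finset.range n, ENNReal.ofReal (jumpProb α (i + 1) n) • gam (h ^ α) (i + 1)

lemma isFiniteMeasure_mixMeasure (α : ℝ) {h : ℝ} (hh : 0 < h) (n : ℕ) :
    IsFiniteMeasure (mixMeasure α h n) := by
  have hl : 0 < h ^ α := Real.rpow_pos_of_pos hh α
  refine ⟨?_⟩
  rw [mixMeasure, Measure.finsetSum_apply]
  refine ENNReal.sum_lt_top.mpr fun i _ => ?_
  have := isFiniteMeasure_gam hl (Nat.le_add_left 1 i)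
  rw [Measure.smul_apply, smul_eq_mul]
  exact ENNReal.mul_lt_top ENNReal.ofReal_lt_top (measure_lt_top _ _)

lemma mixMeasure_pos (α h : ℝ) (n : ℕ) : ∀ᵐ t ∂(mixMeasure α h n), 0 < t := by
  rw [ae_iff, mixMeasure, Measure.finsetSum_apply]
  refine Finset.sum_eq_zero fun i _ => ?_
  rw [Measure.smul_apply, ae_iff.mp (gam_pos (h ^ α) (i + 1)), smul_zero]

lemma integrable_exp_neg {μ : Measure ℝ} [IsFiniteMeasure μ] (hμ : ∀ᵐ t ∂μ, 0 < t) {κ : ℝ}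
    (hκ : 0 ≤ κ) : Integrable (fun t => Real.exp (-(κ * t))) μ := by
  refine (integrable_const (1 : ℝ)).mono' (by fun_prop) ?_
  filter_upwards [hμ] with t ht
  rw [Real.norm_of_nonneg (Real.exp_nonneg _), Real.exp_le_one_iff]
  nlinarith

lemma laplace_mixMeasure {α h κ : ℝ} (h0 : 0 ≤ α) (h1 : α ≤ 1) (hh : 0 < h) (hκ : 0 ≤ κ) {n : ℕ}
    (hn : 1 ≤ n) :
    ∫ t, Real.exp (-(κ * t)) ∂(mixMeasure α h n) = jumpGen α ((1 + h ^ α * κ)⁻¹) n := by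
  have hl : 0 < h ^ α := Real.rpow_pos_of_pos hh α
  rw [mixMeasure, integral_finsetSum_measure, jumpGen_eq _ _ hn]
  · refine Finset.sum_congr rfl fun i _ => ?_
    rw [integral_smul_measure, laplace_gam hl hκ (Nat.le_add_left 1 i),
      ENNReal.toReal_ofReal (jumpProb_nonneg h0 h1 _ _), smul_eq_mul]
  · intro i _
    have := isFiniteMeasure_gam hl (Nat.le_add_left 1 i)
    exact (integrable_exp_neg (gam_pos _ _) hκ).smul_measure ENNReal.ofReal_ne_top

/-- The generating function solves the scheme with rate `h ^ α * κ`, and `h ^ α * n ^ α = (nh) ^ α`.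
The bound therefore sees only the time `nh`, which makes the later constants independent of `h`. -/
lemma laplace_mixMeasure_le {α h κ : ℝ} (h0 : 0 ≤ α) (h1 : α ≤ 1) (hh : 0 < h) (hκ : 0 ≤ κ)
    {n : ℕ} (hn : 1 ≤ n) :
    ∫ t, Real.exp (-(κ * t)) ∂(mixMeasure α h n) ≤ 1 / (1 + κ * ((n : ℝ) * h) ^ α) := by
  have hl : 0 < h ^ α := Real.rpow_pos_of_pos hh α
  rw [laplace_mixMeasure h0 h1 hh hκ hn]
  refine (implicit_scheme_le h0 h1 (κ := h ^ α * κ) (by positivity) (jumpGen_zero _ _)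
    (fun m hm => ?_) n hn).trans_eq ?_
  · rw [jumpGen_rec α _ hm, ← mul_assoc, mul_inv_cancel₀ (by positivity), one_mul]
  · rw [Real.mul_rpow (by positivity) hh.le]
    ring_nf

theorem isFundamentalSolution_mix {N : ℕ} {α h : ℝ} (h0 : 0 ≤ α) (h1 : α ≤ 1) (hh : 0 < h) :
    IsFundamentalSolution (N := N) α h (fun n => mix (mixMeasure α h n)) := by
  have := fun n => isFiniteMeasure_mixMeasure α hh n
  have hl : 0 < h ^ α := Real.rpow_pos_of_pos hh α
  refine (isFundamentalSolution_iff hh fun n _ => integrable_mix (mixMeasure_pos α h n)).mpr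
    fun n hn ξ => ?_
  have hs := symb_nonneg ξ
  have e : ∀ j, (if j = 0 then 1 else ft (mix (mixMeasure α h j)) ξ) =
      (jumpGen α ((1 + h ^ α * symb ξ)⁻¹) j : ℂ) := by
    intro j
    split_ifs with hj
    · rw [hj, jumpGen_zero, Complex.ofReal_one]
    · rw [ft_mix (mixMeasure_pos α h j), laplace_mixMeasure h0 h1 hh hs (by omega)]
  have en := e n
  rw [if_neg (by omega)] at en
  simp only [e, en]
  have := jumpGen_rec α ((1 + h ^ α * symb ξ)⁻¹) hn
  have h2 : (1 + h ^ α * symb ξ) * jumpGen α ((1 + h ^ α * symb ξ)⁻¹) n =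
      ∑ j ∈ Finset.range n, histWeight α n j * jumpGen α ((1 + h ^ α * symb ξ)⁻¹) j := by
    rw [this, ← mul_assoc, mul_inv_cancel₀ (by positivity), one_mul]
  exact_mod_cast h2

/-! ### The subordination series -/

/-- The bound is uniform in `t`: it is `z ≤ exp z` raised to the power `N/2`, with `z` proportional
to `‖x‖ ^ 2 / t`. It makes all terms `discreteGauss h (j + 1) x` bounded in `j` away from the
origin. -/
lemma gaussKernel_le {N : ℕ} (hN : 1 ≤ N) {t : ℝ} (ht : 0 < t) {x : Sp N} (hx : x ≠ 0) :
    gaussKernel t x ≤ ((N : ℝ) / 2 / (Real.pi * ‖x‖ ^ 2)) ^ ((N : ℝ) / 2) := by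
  set a : ℝ := (N : ℝ) / 2 with ha
  have ha0 : 0 < a := by
    have : (0 : ℝ) < N := by exact_mod_cast hN
    positivity
  have hb : 0 < Real.pi * ‖x‖ ^ 2 := by positivity
  set z : ℝ := ‖x‖ ^ 2 / (4 * t) / a with hz
  have hz0 : 0 < z := by positivity
  have h1 : z ^ a ≤ Real.exp (‖x‖ ^ 2 / (4 * t)) := by
    have h2 : z ≤ Real.exp z := by linarith [Real.add_one_le_exp z]
    refine (Real.rpow_le_rpow hz0.le h2 ha0.le).trans_eq ?_
    rw [← Real.exp_mul]
    congr 1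
    rw [hz]
    field_simp
  have e : (4 * Real.pi * t) ^ (-a) = (a / (Real.pi * ‖x‖ ^ 2)) ^ a * z ^ a := by
    rw [← Real.mul_rpow (by positivity) hz0.le, Real.rpow_neg (by positivity),
      ← Real.inv_rpow (by positivity)]
    congr 1
    rw [hz]
    field_simp
  rw [gaussKernel, e, mul_assoc, Real.exp_neg]
  refine mul_le_of_le_one_right (by positivity) ?_
  rw [← div_eq_mul_inv]
  exact div_le_one_of_le₀ h1 (Real.exp_nonneg _)

lemma measureReal_gam_univ {h : ℝ} (hh : 0 < h) {i : ℕ} (hi : 1 ≤ i) :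
    (gam h i).real Set.univ = 1 := by
  have := laplace_gam hh le_rfl hi
  simpa using this

lemma abs_discreteGauss_le {N : ℕ} (hN : 1 ≤ N) {h : ℝ} (hh : 0 < h) {i : ℕ} (hi : 1 ≤ i)
    {x : Sp N} (hx : x ≠ 0) :
    |discreteGauss h i x| ≤ ((N : ℝ) / 2 / (Real.pi * ‖x‖ ^ 2)) ^ ((N : ℝ) / 2) := by
  have := isFiniteMeasure_gam hh hi
  rw [discreteGauss_eq_mix hh, mix, ← Real.norm_eq_abs]
  refine (norm_integral_le_of_norm_le_const ?_).trans_eq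
    (by rw [measureReal_gam_univ hh hi, mul_one])
  filter_upwards [gam_pos h i] with t ht
  rw [Real.norm_of_nonneg (gaussKernel_nonneg ht x)]
  exact gaussKernel_le hN ht hx

/-- A mixture is nonnegative, so its `L¹` norm is its Fourier transform at `0`, the total mass of
`μ`. -/
lemma integral_norm_mix {N : ℕ} {μ : Measure ℝ} [IsFiniteMeasure μ] (hμ : ∀ᵐ t ∂μ, 0 < t) :
    ∫ x : Sp N, ‖mix μ x‖ = μ.real Set.univ := by
  have h1 := re_ft (integrable_mix (N := N) hμ) 0
  rw [ft_mix hμ, Complex.ofReal_re] at h1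
  simp only [symb, norm_zero, inner_zero_right, mul_zero, Real.cos_zero, one_mul] at h1
  have h2 : ∀ x : Sp N, ‖mix μ x‖ = mix μ x := fun x => Real.norm_of_nonneg
    (integral_nonneg_of_ae (hμ.mono fun t ht => gaussKernel_nonneg ht x))
  simp only [h2, ← h1]
  simp

/-- Tonelli bounds the norm. Pointwise summability serves measurability, making the sum a limit of
partial sums. -/
lemma integrable_tsum {X : Type*} [MeasurableSpace X] {μ : Measure X} {F : ℕ → X → ℝ}
    (hF : ∀ i, Integrable (F i) μ) (hs : Summable fun i => ∫ x, ‖F i x‖ ∂μ)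
    (hpt : ∀ᵐ x ∂μ, Summable fun i => F i x) : Integrable (fun x => ∑' i, F i x) μ := by
  have hm : AEStronglyMeasurable (fun x => ∑' i, F i x) μ := by
    refine aestronglyMeasurable_of_tendsto_ae atTop
      (f := fun n x => ∑ i ∈ Finset.range n, F i x)
      (fun n => Finset.aestronglyMeasurable_fun_sum _ fun i _ => (hF i).1) ?_
    filter_upwards [hpt] with x hx
    exact hx.hasSum.tendsto_sum_nat
  refine ⟨hm, ?_⟩
  calc ∫⁻ x, ‖∑' i, F i x‖ₑ ∂μ ≤ ∫⁻ x, ∑' i, ‖F i x‖ₑ ∂μ :=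
        lintegral_mono fun x => enorm_tsum_le_tsum_enorm
    _ = ∑' i, ∫⁻ x, ‖F i x‖ₑ ∂μ := lintegral_tsum fun i => (hF i).1.enorm
    _ = ∑' i, ENNReal.ofReal (∫ x, ‖F i x‖ ∂μ) := by
        refine tsum_congr fun i => ?_
        rw [ofReal_integral_norm_eq_lintegral_enorm (hF i)]
    _ < ⊤ := by
        rw [← ENNReal.ofReal_tsum_of_nonneg (fun i => integral_nonneg fun _ => norm_nonneg _) hs]
        exact ENNReal.ofReal_lt_top

section

variable {N : ℕ} {α h : ℝ}

theorem summable_subord (hN : 1 ≤ N) (hh : 0 < h) (h2 : h ^ (1 - α) < 2) (n : ℕ) {x : Sp N}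
    (hx : x ≠ 0) :
    Summable fun j : ℕ => wright α (1 - α) h n j * discreteGauss h (j + 1) x := by
  obtain ⟨q, hq0, hq1, hq⟩ := exists_wright_bound (β := 1 - α) hh h2
  obtain ⟨C, hC⟩ := hq n
  set S := ((N : ℝ) / 2 / (Real.pi * ‖x‖ ^ 2)) ^ ((N : ℝ) / 2)
  refine Summable.of_norm_bounded (g := fun j => C * q ^ j * S)
    (((summable_geometric_of_lt_one hq0 hq1).mul_left C).mul_right S) fun j => ?_
  rw [norm_mul, Real.norm_eq_abs, Real.norm_eq_abs]
  exact mul_le_mul (hC j) (abs_discreteGauss_le hN hh (Nat.le_add_left 1 j) hx) (abs_nonneg _)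
    ((abs_nonneg _).trans (hC j))

lemma integrable_discreteGauss (hh : 0 < h) (j : ℕ) :
    Integrable (discreteGauss (N := N) h (j + 1)) := by
  have := isFiniteMeasure_gam hh (Nat.le_add_left 1 j)
  rw [discreteGauss_eq_mix hh]
  exact integrable_mix (gam_pos _ _)

lemma integral_norm_discreteGauss (hh : 0 < h) (j : ℕ) :
    ∫ x, ‖discreteGauss (N := N) h (j + 1) x‖ = 1 := by
  have := isFiniteMeasure_gam hh (Nat.le_add_left 1 j)
  rw [discreteGauss_eq_mix hh, integral_norm_mix (gam_pos _ _),
    measureReal_gam_univ hh (Nat.le_add_left 1 j)]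

lemma ft_discreteGauss (hh : 0 < h) (j : ℕ) (ξ : Sp N) :
    ft (discreteGauss (N := N) h (j + 1)) ξ = ((((1 + h * symb ξ)⁻¹) ^ (j + 1) : ℝ) : ℂ) := by
  have := isFiniteMeasure_gam hh (Nat.le_add_left 1 j)
  rw [discreteGauss_eq_mix hh, ft_mix (gam_pos _ _),
    laplace_gam hh (symb_nonneg ξ) (Nat.le_add_left 1 j)]

lemma summable_wright (hh : 0 < h) (h2 : h ^ (1 - α) < 2) (n : ℕ) :
    Summable fun j : ℕ => |wright α (1 - α) h n j| := by
  obtain ⟨q, hq0, hq1, hq⟩ := exists_wright_bound (β := 1 - α) hh h2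
  obtain ⟨C, hC⟩ := hq n
  exact Summable.of_nonneg_of_le (fun _ => abs_nonneg _) hC
    ((summable_geometric_of_lt_one hq0 hq1).mul_left C)

lemma integrable_subordKernel (hN : 1 ≤ N) (hh : 0 < h) (h2 : h ^ (1 - α) < 2) (n : ℕ) :
    Integrable (subordKernel (N := N) α h n) := by
  refine integrable_tsum (F := fun j x => wright α (1 - α) h (n - 1) j * discreteGauss h (j + 1) x)
    (fun j => (integrable_discreteGauss hh j).const_mul _) ?_ ?_
  · refine (summable_wright hh h2 (n - 1)).congr fun j => ?_
    simp only [norm_mul]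
    rw [integral_const_mul, integral_norm_discreteGauss hh, mul_one, Real.norm_eq_abs]
  · have : Nontrivial (Sp N) := by
      have : Nonempty (Fin N) := ⟨⟨0, hN⟩⟩
      infer_instance
    filter_upwards [Measure.ae_ne volume (0 : Sp N)] with x hx
    exact summable_subord hN hh h2 (n - 1) hx

lemma hasSum_ft_subordKernel (hh : 0 < h) (h2 : h ^ (1 - α) < 2) (n : ℕ) (ξ : Sp N) :
    HasSum (fun j : ℕ => ((wright α (1 - α) h (n - 1) j * ((1 + h * symb ξ)⁻¹) ^ (j + 1) : ℝ) : ℂ))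
      (ft (subordKernel (N := N) α h n) ξ) := by
  have hF : ∀ j, Integrable fun x : Sp N => (wright α (1 - α) h (n - 1) j *
      discreteGauss h (j + 1) x) • Complex.exp ((-2 * Real.pi * inner ℝ x ξ : ℝ) * Complex.I) :=
    fun j => integrable_smul_char ((integrable_discreteGauss hh j).const_mul _) ξ
  have hs := hasSum_integral_of_summable_integral_norm hF ?_
  · have e : ∀ j, ∫ x : Sp N, (wright α (1 - α) h (n - 1) j * discreteGauss h (j + 1) x) •
        Complex.exp ((-2 * Real.pi * inner ℝ x ξ : ℝ) * Complex.I) =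
        ((wright α (1 - α) h (n - 1) j * ((1 + h * symb ξ)⁻¹) ^ (j + 1) : ℝ) : ℂ) := by
      intro j
      simp only [mul_smul]
      rw [integral_smul, ← ft_eq_integral_smul, ft_discreteGauss hh, Complex.real_smul,
        ← Complex.ofReal_mul]
    simp only [e] at hs
    have e2 : ft (subordKernel (N := N) α h n) ξ = ∫ x : Sp N, ∑' j : ℕ,
        (wright α (1 - α) h (n - 1) j * discreteGauss h (j + 1) x) •
          Complex.exp ((-2 * Real.pi * inner ℝ x ξ : ℝ) * Complex.I) := by
      rw [ft_eq_integral_smul]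
      refine integral_congr_ae (Eventually.of_forall fun x => ?_)
      simp only [Complex.real_smul, subordKernel]
      rw [tsum_mul_right, Complex.ofReal_tsum]
    rw [e2]
    exact hs
  · refine (summable_wright hh h2 (n - 1)).congr fun j => ?_
    simp only [norm_smul, Complex.norm_exp_ofReal_mul_I, mul_one, norm_mul]
    rw [integral_const_mul, integral_norm_discreteGauss hh, mul_one, Real.norm_eq_abs]

theorem isFundamentalSolution_subordKernel (hN : 1 ≤ N) (hh : 0 < h) (h2 : h ^ (1 - α) < 2) :
    IsFundamentalSolution α h (subordKernel (N := N) α h) := by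
  refine (isFundamentalSolution_iff hh fun n _ => integrable_subordKernel hN hh h2 n).mpr
    fun n hn ξ => ?_
  set κ := symb ξ with hκ
  have hκ0 : 0 ≤ κ := symb_nonneg ξ
  set x : ℝ := (1 + h * κ)⁻¹ with hx
  have hx0 : 0 ≤ x := by positivity
  have hx1 : x ≤ 1 := inv_le_one_of_one_le₀ (by nlinarith)
  set V : ℕ → ℝ := fun m => if m = 0 then 1 else ∑' j, wright α (1 - α) h (m - 1) j * x ^ (j + 1)
    with hV
  have hft : ∀ m, m ≠ 0 → ft (subordKernel (N := N) α h m) ξ = (V m : ℂ) := by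
    intro m hm
    rw [← (hasSum_ft_subordKernel hh h2 m ξ).tsum_eq, ← Complex.ofReal_tsum]
    simp [hV, hm, hx, hκ]
  have hsum : ∀ m, Summable fun j => wright α (1 - α) h m j * x ^ (j + 1) := fun m =>
    Summable.of_norm_bounded (summable_wright hh h2 m) fun j => by
      rw [norm_mul, Real.norm_eq_abs, Real.norm_of_nonneg (pow_nonneg hx0 _)]
      exact mul_le_of_le_one_right (abs_nonneg _) (pow_le_one₀ hx0 hx1)
  have hVlim : ∀ m, Tendsto (fun J => if m = 0 then (1 : ℝ) else
      ∑ j ∈ Finset.range J, wright α (1 - α) h (m - 1) j * x ^ (j + 1)) atTop (𝓝 (V m)) := by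
    intro m
    by_cases hm : m = 0
    · simp [hV, hm]
    · simpa [hV, hm] using (hsum (m - 1)).hasSum.tendsto_sum_nat
  have hn0 : n ≠ 0 := by omega
  -- Let `J → ∞` in `caputo_wright_partial`; the error vanishes because `0 ≤ x ≤ 1` and the Wright
  -- coefficients are summable.
  have hcap : caputo α h V n = -κ * V n := by
    have l1 : Tendsto (fun J => caputo α h (fun m => if m = 0 then 1 else
        ∑ j ∈ Finset.range J, wright α (1 - α) h (m - 1) j * x ^ (j + 1)) n) atTop
        (𝓝 (caputo α h V n)) := by
      simp only [caputo_eq α hh _ hn]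
      exact ((hVlim n).sub (tendsto_finsetSum _ fun j _ => (hVlim j).const_mul _)).const_mul _
    have l2 : Tendsto (fun J => -κ * (∑ j ∈ Finset.range J,
          wright α (1 - α) h (n - 1) j * x ^ (j + 1)) -
        h⁻¹ * x ^ J * wright α (1 - α) h (n - 1) J) atTop (𝓝 (-κ * V n - 0)) := by
      refine Tendsto.sub (Tendsto.const_mul _ (by simpa [hn0] using hVlim n)) ?_
      have hw : Tendsto (fun J => h⁻¹ * |wright α (1 - α) h (n - 1) J|) atTop (𝓝 0) := by
        simpa using (summable_wright hh h2 (n - 1)).tendsto_atTop_zero.const_mul h⁻¹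
      refine squeeze_zero_norm (fun J => ?_) hw
      rw [norm_mul, norm_mul, Real.norm_of_nonneg (inv_nonneg.mpr hh.le),
        Real.norm_of_nonneg (pow_nonneg hx0 _), Real.norm_eq_abs, mul_assoc]
      refine mul_le_mul_of_nonneg_left ?_ (inv_nonneg.mpr hh.le)
      exact mul_le_of_le_one_left (abs_nonneg _) (pow_le_one₀ hx0 hx1)
    rw [sub_zero] at l2
    refine tendsto_nhds_unique l1 (l2.congr fun J => ?_)
    rw [caputo_wright_partial hh hκ0 J n hn]
  rw [caputo_eq α hh _ hn] at hcap
  have hr : (1 + h ^ α * κ) * V n = ∑ j ∈ Finset.range n, histWeight α n j * V j := by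
    have hc : h ^ α * h ^ (-α) = 1 := by rw [← Real.rpow_add hh]; simp
    linear_combination (h ^ α) * hcap -
      (V n - ∑ j ∈ Finset.range n, histWeight α n j * V j) * hc
  have hV' : ∀ j, (if j = 0 then 1 else ft (subordKernel (N := N) α h j) ξ) = (V j : ℂ) := by
    intro j
    split_ifs with hj
    · simp [hV, hj]
    · exact hft j hj
  rw [hft n hn0]
  simp only [hV']
  exact_mod_cast hr

end

/-! ### Minkowski's integral inequality -/

/-- Minkowski's integral inequality in terms of a majorant `a` of the norms of the sections. -/
theorem lintegral_rpow_lintegral_le {X T : Type*} [MeasurableSpace X] [MeasurableSpace T]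
    {μ : Measure X} {ν : Measure T} [SFinite μ] [SFinite ν] {p : ℝ} (hp : 1 ≤ p)
    {F : X → T → ℝ≥0∞} (hF : Measurable (Function.uncurry F)) {a : T → ℝ≥0∞} (ha : Measurable a)
    (ha0 : ∀ᵐ t ∂ν, a t ≠ 0) (hatop : ∀ᵐ t ∂ν, a t ≠ ⊤)
    (hb : ∀ᵐ t ∂ν, ∫⁻ x, F x t ^ p ∂μ ≤ a t ^ p) :
    ∫⁻ x, (∫⁻ t, F x t ∂ν) ^ p ∂μ ≤ (∫⁻ t, a t ∂ν) ^ p := by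
  rcases hp.eq_or_lt with rfl | hp1
  · simp only [ENNReal.rpow_one] at hb ⊢
    rw [lintegral_lintegral_swap hF.aemeasurable]
    exact lintegral_mono_ae hb
  have hp0 : 0 < p := by linarith
  have hpq : p.HolderConjugate p.conjExponent := .conjExponent hp1
  set q := p.conjExponent with hq
  have hq0 : 0 < q := hpq.symm.pos
  have hpq1 : 1 / q * p = p - 1 := by
    have := hpq.inv_add_inv_eq_one
    field_simp at this ⊢
    linarith
  set A := ∫⁻ t, a t ∂ν with hA
  have hFx : ∀ x, Measurable (F x) := fun x => hF.comp measurable_prodMk_left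
  have hFt : ∀ t, Measurable (fun x => F x t) := fun t => hF.comp measurable_prodMk_right
  -- Hölder for `F = (F a ^ (-1/q)) (a ^ (1/q))`, which needs `a` nonzero and finite. Integrating in
  -- `x` then uses `hb` section by section.
  have hpt : ∀ x, (∫⁻ t, F x t ∂ν) ^ p ≤ (∫⁻ t, F x t ^ p * a t ^ (1 - p) ∂ν) * A ^ (p - 1) := by
    intro x
    have e1 : ∫⁻ t, F x t ∂ν = ∫⁻ t, ((fun t => F x t * a t ^ (-(1 / q))) *
        fun t => a t ^ (1 / q)) t ∂ν := by
      refine lintegral_congr_ae ?_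
      filter_upwards [ha0, hatop] with t h0 h1
      rw [Pi.mul_apply, mul_assoc, ← ENNReal.rpow_add _ _ h0 h1]
      simp
    have h := ENNReal.lintegral_mul_le_Lp_mul_Lq ν hpq
      (f := fun t => F x t * a t ^ (-(1 / q))) (g := fun t => a t ^ (1 / q))
      ((hFx x).mul (ha.pow_const _)).aemeasurable (ha.pow_const _).aemeasurable
    rw [← e1] at h
    have e2 : ∀ t, (F x t * a t ^ (-(1 / q))) ^ p = F x t ^ p * a t ^ (1 - p) := by
      intro t
      rw [ENNReal.mul_rpow_of_nonneg _ _ hp0.le, ← ENNReal.rpow_mul, neg_mul, hpq1, neg_sub]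
    have e3 : ∀ t, (a t ^ (1 / q)) ^ q = a t := by
      intro t
      rw [← ENNReal.rpow_mul, one_div_mul_cancel hq0.ne', ENNReal.rpow_one]
    simp only [e2, e3] at h
    refine (ENNReal.rpow_le_rpow h hp0.le).trans_eq ?_
    rw [ENNReal.mul_rpow_of_nonneg _ _ hp0.le, ← ENNReal.rpow_mul, ← ENNReal.rpow_mul,
      one_div_mul_cancel hp0.ne', ENNReal.rpow_one, hpq1]
  have hm : Measurable (Function.uncurry fun x t => F x t ^ p * a t ^ (1 - p)) :=
    (hF.pow_const p).mul ((ha.comp measurable_snd).pow_const _)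
  calc ∫⁻ x, (∫⁻ t, F x t ∂ν) ^ p ∂μ
      ≤ ∫⁻ x, (∫⁻ t, F x t ^ p * a t ^ (1 - p) ∂ν) * A ^ (p - 1) ∂μ := lintegral_mono hpt
    _ = (∫⁻ x, ∫⁻ t, F x t ^ p * a t ^ (1 - p) ∂ν ∂μ) * A ^ (p - 1) :=
        lintegral_mul_const _ hm.lintegral_prod_right'
    _ = (∫⁻ t, ∫⁻ x, F x t ^ p * a t ^ (1 - p) ∂μ ∂ν) * A ^ (p - 1) := by
        rw [lintegral_lintegral_swap hm.aemeasurable]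
    _ ≤ (∫⁻ t, a t ∂ν) * A ^ (p - 1) := by
        gcongr ?_ * _
        refine lintegral_mono_ae ?_
        filter_upwards [ha0, hatop, hb] with t h0 h1 hbt
        rw [lintegral_mul_const _ ((hFt t).pow_const p)]
        refine (mul_le_mul_left hbt _).trans_eq ?_
        rw [← ENNReal.rpow_add _ _ h0 h1]
        simp
    _ = A ^ p := by
        rw [← hA]
        nth_rewrite 1 [← ENNReal.rpow_one A]
        rw [← ENNReal.rpow_add_of_nonneg _ _ zero_le_one (by linarith)]
        simp

/-- Serves three averages: over the mixing time, over a segment of translations, and over the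
convolution variable. -/
theorem eLpNorm_le_lintegral {X T : Type*} [MeasurableSpace X] [MeasurableSpace T]
    {μ : Measure X} {ν : Measure T} [SFinite μ] [SFinite ν] {p : ℝ} (hp : 1 ≤ p)
    {Φ : X → T → ℝ} (hΦ : Measurable (Function.uncurry Φ)) {a : T → ℝ≥0∞} (ha : Measurable a)
    (ha0 : ∀ᵐ t ∂ν, a t ≠ 0) (hatop : ∀ᵐ t ∂ν, a t ≠ ⊤)
    (hb : ∀ᵐ t ∂ν, eLpNorm (fun x => Φ x t) (ENNReal.ofReal p) μ ≤ a t) {g : X → ℝ}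
    (hg : ∀ᵐ x ∂μ, ‖g x‖ₑ ≤ ∫⁻ t, ‖Φ x t‖ₑ ∂ν) :
    eLpNorm g (ENNReal.ofReal p) μ ≤ ∫⁻ t, a t ∂ν := by
  have hp0 : 0 < p := by linarith
  have hpz : ENNReal.ofReal p ≠ 0 := by simpa using hp0
  have hform : ∀ g : X → ℝ, eLpNorm g (ENNReal.ofReal p) μ = (∫⁻ x, ‖g x‖ₑ ^ p ∂μ) ^ (1 / p) := by
    intro g
    rw [eLpNorm_eq_lintegral_rpow_enorm_toReal hpz ENNReal.ofReal_ne_top,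
      ENNReal.toReal_ofReal hp0.le]
  have hroot : ∀ c : ℝ≥0∞, (c ^ p) ^ (1 / p) = c := fun c => by
    rw [← ENNReal.rpow_mul, mul_one_div_cancel hp0.ne', ENNReal.rpow_one]
  have hroot' : ∀ c : ℝ≥0∞, (c ^ (1 / p)) ^ p = c := fun c => by
    rw [← ENNReal.rpow_mul, one_div_mul_cancel hp0.ne', ENNReal.rpow_one]
  rw [hform, ← hroot (∫⁻ t, a t ∂ν)]
  refine ENNReal.rpow_le_rpow ?_ (by positivity)
  refine (lintegral_mono_ae ?_).trans (lintegral_rpow_lintegral_le hp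
    (F := fun x t => ‖Φ x t‖ₑ) hΦ.enorm ha ha0 hatop ?_)
  · filter_upwards [hg] with x hx
    exact ENNReal.rpow_le_rpow hx hp0.le
  · filter_upwards [hb] with t ht
    rw [hform] at ht
    have := ENNReal.rpow_le_rpow ht hp0.le
    rwa [hroot'] at this

/-! ### Negative moments from Laplace transforms -/

lemma lintegral_rpow_mul_exp {γ t : ℝ} (hγ : 0 < γ) (ht : 0 < t) :
    ∫⁻ κ in Set.Ioi (0 : ℝ), ENNReal.ofReal (κ ^ (γ - 1) * Real.exp (-(t * κ))) =
      ENNReal.ofReal ((1 / t) ^ γ * Real.Gamma γ) := by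
  have h := Real.integral_rpow_mul_exp_neg_mul_Ioi hγ ht
  have hpos : 0 < (1 / t) ^ γ * Real.Gamma γ :=
    mul_pos (by positivity) (Real.Gamma_pos_of_pos hγ)
  have hi : Integrable (fun κ : ℝ => κ ^ (γ - 1) * Real.exp (-(t * κ)))
      (volume.restrict (Set.Ioi 0)) := by
    by_contra hc
    rw [integral_undef hc] at h
    linarith
  rw [← h, ofReal_integral_eq_lintegral_ofReal hi]
  filter_upwards [ae_restrict_mem measurableSet_Ioi] with κ hκ
  have : (0 : ℝ) < κ := hκ
  positivity

/-- If the Laplace transform of `μ` is dominated by that of an exponential variable of mean `c`,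
then so are its negative moments of order less than one. -/
theorem lintegral_rpow_neg_le {μ : Measure ℝ} [SFinite μ] (hμ : ∀ᵐ t ∂μ, 0 < t) {c γ : ℝ}
    (hc : 0 < c) (hγ0 : 0 ≤ γ) (hγ1 : γ < 1)
    (hL : ∀ κ : ℝ, 0 ≤ κ →
      ∫⁻ t, ENNReal.ofReal (Real.exp (-(κ * t))) ∂μ ≤ ENNReal.ofReal (1 / (1 + κ * c))) :
    ∫⁻ t, ENNReal.ofReal (t ^ (-γ)) ∂μ ≤ ENNReal.ofReal (Real.Gamma (1 - γ) * c ^ (-γ)) := by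
  -- Euler's integral for `t ^ (-γ)` diverges at `γ = 0`, where the claim is the hypothesis at `κ =
  -- 0`.
  rcases hγ0.eq_or_lt with rfl | hγ
  · simpa using hL 0 le_rfl
  have hG : 0 < Real.Gamma γ := Real.Gamma_pos_of_pos hγ
  have e1 : ∫⁻ t, ENNReal.ofReal (Real.Gamma γ) * ENNReal.ofReal (t ^ (-γ)) ∂μ =
      ∫⁻ t, (∫⁻ κ in Set.Ioi (0 : ℝ), ENNReal.ofReal (κ ^ (γ - 1) * Real.exp (-(t * κ)))) ∂μ := by
    refine lintegral_congr_ae ?_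
    filter_upwards [hμ] with t ht
    rw [lintegral_rpow_mul_exp hγ ht, ← ENNReal.ofReal_mul hG.le, mul_comm, one_div,
      Real.inv_rpow ht.le, Real.rpow_neg ht.le]
  have hm1 : Measurable (Function.uncurry fun t κ : ℝ =>
      ENNReal.ofReal (κ ^ (γ - 1) * Real.exp (-(t * κ)))) := by
    unfold Function.uncurry
    fun_prop
  -- Writing `1 / (1 + κ c)` as `∫ exp (-(1 + κ c) s) ds` allows a second exchange of integrals. The
  -- `κ` integral gives `Γ(γ) (c s) ^ (-γ)`, and the `s` integral then gives `Γ(1 - γ)`, finite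
  -- because `γ < 1`.
  have e2 : ∀ κ ∈ Set.Ioi (0 : ℝ),
      ∫⁻ t, ENNReal.ofReal (κ ^ (γ - 1) * Real.exp (-(t * κ))) ∂μ ≤
      ∫⁻ s in Set.Ioi (0 : ℝ), ENNReal.ofReal (κ ^ (γ - 1) * Real.exp (-((1 + κ * c) * s))) := by
    intro κ hκ
    have hκ' : (0 : ℝ) < κ := hκ
    have hk : 0 ≤ κ ^ (γ - 1) := by positivity
    have h1 := lintegral_rpow_mul_exp (γ := 1) (t := 1 + κ * c) one_pos (by positivity)
    simp only [sub_self, Real.rpow_zero, one_mul, Real.rpow_one, Real.Gamma_one, mul_one] at h1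
    simp only [ENNReal.ofReal_mul hk]
    rw [lintegral_const_mul _ (by fun_prop), lintegral_const_mul _ (by fun_prop), h1]
    gcongr
    simpa only [mul_comm] using hL κ hκ'.le
  have hm2 : Measurable (Function.uncurry fun κ s : ℝ =>
      ENNReal.ofReal (κ ^ (γ - 1) * Real.exp (-((1 + κ * c) * s)))) := by
    unfold Function.uncurry
    fun_prop
  have e3 : ∀ s ∈ Set.Ioi (0 : ℝ),
      ∫⁻ κ in Set.Ioi (0 : ℝ), ENNReal.ofReal (κ ^ (γ - 1) * Real.exp (-((1 + κ * c) * s))) =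
      ENNReal.ofReal (c ^ (-γ) * Real.Gamma γ) *
        ENNReal.ofReal (s ^ ((1 - γ) - 1) * Real.exp (-(1 * s))) := by
    intro s hs
    have hs' : (0 : ℝ) < s := hs
    have h1 := lintegral_rpow_mul_exp hγ (mul_pos hc hs')
    have : ∀ κ : ℝ, ENNReal.ofReal (κ ^ (γ - 1) * Real.exp (-((1 + κ * c) * s))) =
        ENNReal.ofReal (Real.exp (-s)) *
          ENNReal.ofReal (κ ^ (γ - 1) * Real.exp (-(c * s * κ))) := by
      intro κ
      rw [← ENNReal.ofReal_mul (Real.exp_nonneg _),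
        show -((1 + κ * c) * s) = -s + -(c * s * κ) by ring, Real.exp_add]
      ring_nf
    simp only [this]
    rw [lintegral_const_mul _ (by fun_prop), h1, ← ENNReal.ofReal_mul (Real.exp_nonneg _),
      ← ENNReal.ofReal_mul (by positivity)]
    congr 1
    rw [one_div, Real.inv_rpow (by positivity), Real.mul_rpow hc.le hs'.le, Real.rpow_neg hc.le,
      show 1 - γ - 1 = -γ by ring, Real.rpow_neg hs'.le, mul_inv, one_mul]
    ring
  have key : ENNReal.ofReal (Real.Gamma γ) * ∫⁻ t, ENNReal.ofReal (t ^ (-γ)) ∂μ ≤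
      ENNReal.ofReal (Real.Gamma γ) * ENNReal.ofReal (Real.Gamma (1 - γ) * c ^ (-γ)) := by
    rw [← lintegral_const_mul _ (by fun_prop), e1, lintegral_lintegral_swap hm1.aemeasurable]
    refine (setLIntegral_mono' measurableSet_Ioi e2).trans ?_
    rw [lintegral_lintegral_swap hm2.aemeasurable, setLIntegral_congr_fun measurableSet_Ioi e3,
      lintegral_const_mul _ (by fun_prop), lintegral_rpow_mul_exp (by linarith) one_pos,
      ← ENNReal.ofReal_mul (by positivity), ← ENNReal.ofReal_mul hG.le]
    simp only [div_one, Real.one_rpow, one_mul]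
    refine le_of_eq ?_
    congr 1
    ring
  exact (ENNReal.mul_le_mul_iff_right (by simpa using hG) ENNReal.ofReal_ne_top).mp key

lemma lintegral_mixMeasure_rpow_neg_le {α h γ : ℝ} (h0 : 0 ≤ α) (h1 : α ≤ 1) (hh : 0 < h)
    (hγ0 : 0 ≤ γ) (hγ1 : γ < 1) {n : ℕ} (hn : 1 ≤ n) :
    ∫⁻ t, ENNReal.ofReal (t ^ (-γ)) ∂(mixMeasure α h n) ≤
      ENNReal.ofReal (Real.Gamma (1 - γ) * ((n : ℝ) * h) ^ (-(α * γ))) := by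
  have := isFiniteMeasure_mixMeasure α hh n
  have hn' : (0 : ℝ) < n := by exact_mod_cast hn
  have hnh : 0 < (n : ℝ) * h := by positivity
  have := lintegral_rpow_neg_le (mixMeasure_pos α h n) (c := ((n : ℝ) * h) ^ α) (by positivity)
    hγ0 hγ1 fun κ hκ => by
      rw [← ofReal_integral_eq_lintegral_ofReal (integrable_exp_neg (mixMeasure_pos α h n) hκ)
        (Eventually.of_forall fun _ => (Real.exp_nonneg _))]
      exact ENNReal.ofReal_le_ofReal (laplace_mixMeasure_le h0 h1 hh hκ hn)
  rwa [← Real.rpow_mul hnh.le, mul_neg] at this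

/-! ### Lebesgue norms of Gaussian mixtures -/

lemma gaussKernel_rpow {N : ℕ} {t p : ℝ} (ht : 0 < t) (x : Sp N) :
    gaussKernel t x ^ p = (4 * Real.pi * t) ^ (-((N : ℝ) / 2) * p) *
      Real.exp (-(‖x‖ ^ 2 / (4 * (t / p)))) := by
  rw [gaussKernel, Real.mul_rpow (by positivity) (Real.exp_nonneg _),
    ← Real.rpow_mul (by positivity),
    ← Real.exp_mul]
  congr 2
  field_simp

/-- The `p`-th power of a Gaussian is a multiple of the Gaussian at time `t / p`. The constants left
over, powers of `p` and `4π`, are at most one and are dropped. -/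
lemma eLpNorm_gaussKernel_le {N : ℕ} {t p : ℝ} (hp : 1 ≤ p) (ht : 0 < t) :
    eLpNorm (gaussKernel (N := N) t) (ENNReal.ofReal p) volume ≤
      ENNReal.ofReal (t ^ (-((N : ℝ) / 2 * (1 - 1 / p)))) := by
  have hp0 : 0 < p := by linarith
  have hpz : ENNReal.ofReal p ≠ 0 := by simpa using hp0
  rw [eLpNorm_eq_lintegral_rpow_enorm_toReal hpz ENNReal.ofReal_ne_top, ENNReal.toReal_ofReal hp0.le]
  have e1 : ∀ x : Sp N, ‖gaussKernel t x‖ₑ ^ p =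
      ENNReal.ofReal ((4 * Real.pi * t) ^ (-((N : ℝ) / 2) * p) *
        Real.exp (-(‖x‖ ^ 2 / (4 * (t / p))))) := by
    intro x
    rw [Real.enorm_eq_ofReal (gaussKernel_nonneg ht x),
      ENNReal.ofReal_rpow_of_nonneg (gaussKernel_nonneg ht x) hp0.le, gaussKernel_rpow ht]
  have htp : 0 < t / p := by positivity
  have hpos : 0 < 4 * Real.pi * t := by positivity
  simp only [e1]
  rw [← ofReal_integral_eq_lintegral_ofReal ((integrable_exp_neg_norm_sq_div htp).const_mul _)
    (Eventually.of_forall fun x => by positivity), integral_const_mul,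
    integral_exp_neg_norm_sq_div htp, ENNReal.ofReal_rpow_of_nonneg (by positivity) (by positivity)]
  refine ENNReal.ofReal_le_ofReal ?_
  have h1 : (4 * Real.pi * (t / p)) ^ ((N : ℝ) / 2) ≤ (4 * Real.pi * t) ^ ((N : ℝ) / 2) := by
    refine Real.rpow_le_rpow (by positivity) ?_ (by positivity)
    exact mul_le_mul_of_nonneg_left (div_le_self ht.le hp) (by positivity)
  have hg : 0 ≤ (N : ℝ) / 2 * (1 - 1 / p) := by
    have : 1 / p ≤ 1 := by rw [div_le_one hp0]; exact hp
    have : 0 ≤ 1 - 1 / p := by linarith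
    positivity
  calc ((4 * Real.pi * t) ^ (-((N : ℝ) / 2) * p) * (4 * Real.pi * (t / p)) ^ ((N : ℝ) / 2)) ^ (1 / p)
      ≤ ((4 * Real.pi * t) ^ (-((N : ℝ) / 2) * p) * (4 * Real.pi * t) ^ ((N : ℝ) / 2)) ^ (1 / p) := by
        refine Real.rpow_le_rpow (by positivity) ?_ (by positivity)
        exact mul_le_mul_of_nonneg_left h1 (by positivity)
    _ = (4 * Real.pi * t) ^ (-((N : ℝ) / 2 * (1 - 1 / p))) := by
        rw [← Real.rpow_add hpos, ← Real.rpow_mul hpos.le]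
        congr 1
        field_simp
        ring
    _ ≤ t ^ (-((N : ℝ) / 2 * (1 - 1 / p))) := by
        refine Real.rpow_le_rpow_of_nonpos ht ?_ (by linarith)
        have : 1 ≤ 4 * Real.pi := by linarith [Real.pi_gt_three]
        nlinarith

/-- Half of the Gaussian exponent absorbs the factor `‖z‖ / (2t)` at the price `t ^ (-1/2)`. The
other half is the kernel at time `2t`, whose normalisation accounts for `2 ^ (N/2)`. -/
lemma abs_gaussKernel_mul_inner_le {N : ℕ} {t : ℝ} (ht : 0 < t) (z y : Sp N) :
    |gaussKernel t z * (inner ℝ z y / (2 * t))| ≤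
      2 ^ ((N : ℝ) / 2) * ‖y‖ * t ^ (-(1 / 2 : ℝ)) * gaussKernel (2 * t) z := by
  set w : ℝ := ‖z‖ ^ 2 / (4 * (2 * t)) with hw
  have hw0 : 0 ≤ w := by positivity
  have hsq : t ^ (-(1 / 2 : ℝ)) = (Real.sqrt t)⁻¹ := by
    rw [Real.rpow_neg ht.le, Real.sqrt_eq_rpow]
  have hst : 0 < Real.sqrt t := Real.sqrt_pos.mpr ht
  have h1 : ‖z‖ / (2 * t) * Real.exp (-w) ≤ t ^ (-(1 / 2 : ℝ)) := by
    have hx : 2 * w ≤ Real.exp (2 * w) := by linarith [Real.add_one_le_exp (2 * w)]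
    rw [hsq]
    refine abs_le_of_sq_le_sq' ?_ (by positivity) |>.2
    rw [mul_pow, ← Real.exp_nat_mul, inv_pow, Real.sq_sqrt ht.le,
      show ((2 : ℕ) : ℝ) * -w = -(2 * w) by push_cast; ring, Real.exp_neg,
      ← div_eq_mul_inv, div_le_iff₀ (Real.exp_pos _)]
    calc (‖z‖ / (2 * t)) ^ 2 = t⁻¹ * (2 * w) := by rw [hw]; field_simp; ring
      _ ≤ t⁻¹ * Real.exp (2 * w) := by gcongr
  have e1 : gaussKernel t z = 2 ^ ((N : ℝ) / 2) * gaussKernel (2 * t) z * Real.exp (-w) := by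
    rw [gaussKernel, gaussKernel, ← hw, show 4 * Real.pi * (2 * t) = 2 * (4 * Real.pi * t) by ring,
      Real.mul_rpow (by norm_num : (0 : ℝ) ≤ 2) (by positivity : 0 ≤ 4 * Real.pi * t),
      show -(‖z‖ ^ 2 / (4 * t)) = -w + -w by rw [hw]; field_simp; ring, Real.exp_add,
      Real.rpow_neg (by norm_num : (0 : ℝ) ≤ 2)]
    field_simp
  have hG : 0 ≤ gaussKernel (2 * t) z := gaussKernel_nonneg (by positivity) z
  rw [abs_mul, abs_of_nonneg (gaussKernel_nonneg ht z), abs_div, abs_of_pos (by positivity : 0 < 2 * t),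
    e1]
  calc 2 ^ ((N : ℝ) / 2) * gaussKernel (2 * t) z * Real.exp (-w) * (|inner ℝ z y| / (2 * t))
      ≤ 2 ^ ((N : ℝ) / 2) * gaussKernel (2 * t) z * Real.exp (-w) * (‖z‖ * ‖y‖ / (2 * t)) := by
        gcongr
        exact abs_real_inner_le_norm z y
    _ = 2 ^ ((N : ℝ) / 2) * ‖y‖ * (‖z‖ / (2 * t) * Real.exp (-w)) * gaussKernel (2 * t) z := by ring
    _ ≤ _ := by gcongr

lemma hasDerivAt_gaussKernel_line {N : ℕ} {t : ℝ} (ht : 0 < t) (x y : Sp N) (s : ℝ) :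
    HasDerivAt (fun s : ℝ => gaussKernel t (x - s • y))
      (gaussKernel t (x - s • y) * (inner ℝ (x - s • y) y / (2 * t))) s := by
  have h1 : HasDerivAt (fun s : ℝ => x - s • y) (-y) s := by
    simpa using ((hasDerivAt_id s).smul_const y).const_sub x
  have h2 := ((h1.norm_sq.div_const (4 * t)).neg.exp).const_mul
    ((4 * Real.pi * t) ^ (-((N : ℝ) / 2)))
  refine h2.congr_deriv ?_
  simp only [gaussKernel, inner_neg_right, Pi.neg_apply]
  field_simp
  ring

lemma enorm_gaussKernel_sub_le {N : ℕ} {t : ℝ} (ht : 0 < t) (x y : Sp N) :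
    ‖gaussKernel t (x - y) - gaussKernel t x‖ₑ ≤ ∫⁻ s in Set.Ioc (0 : ℝ) 1,
      ‖2 ^ ((N : ℝ) / 2) * ‖y‖ * t ^ (-(1 / 2 : ℝ)) * gaussKernel (2 * t) (x - s • y)‖ₑ := by
  have hc : Continuous fun s : ℝ =>
      gaussKernel t (x - s • y) * (inner ℝ (x - s • y) y / (2 * t)) := by
    have := (continuous_gaussKernel (N := N) t)
    fun_prop
  have h := intervalIntegral.integral_eq_sub_of_hasDerivAt
    (fun s _ => hasDerivAt_gaussKernel_line ht x y s) (hc.intervalIntegrable 0 1)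
  rw [one_smul, zero_smul, sub_zero] at h
  rw [← h, intervalIntegral.integral_of_le zero_le_one]
  refine (enorm_integral_le_lintegral_enorm _).trans (lintegral_mono fun s => ?_)
  rw [enorm_le_iff_norm_le, Real.norm_eq_abs]
  refine (abs_gaussKernel_mul_inner_le ht _ y).trans (le_abs_self _)

lemma eLpNorm_comp_sub {N : ℕ} {g : Sp N → ℝ} (hg : AEStronglyMeasurable g volume) (p : ℝ≥0∞)
    (y : Sp N) : eLpNorm (fun x => g (x - y)) p volume = eLpNorm g p volume :=
  eLpNorm_comp_measurePreserving hg (measurePreserving_sub_right volume y)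

lemma eLpNorm_gaussKernel_sub_le {N : ℕ} {t p : ℝ} (hp : 1 ≤ p) (ht : 0 < t) (y : Sp N) :
    eLpNorm (fun x => gaussKernel t (x - y) - gaussKernel t x) (ENNReal.ofReal p) volume ≤
      ENNReal.ofReal (2 ^ ((N : ℝ) / 2) * ‖y‖ * t ^ (-((N : ℝ) / 2 * (1 - 1 / p) + 1 / 2))) := by
  have hp0 : 0 < p := by linarith
  -- At `y = 0` the majorant would vanish, which Minkowski's inequality in the form above excludes.
  by_cases hy : y = 0
  · simp [hy]
  have hy' : 0 < ‖y‖ := norm_pos_iff.mpr hy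
  set c : ℝ := 2 ^ ((N : ℝ) / 2) * ‖y‖ * t ^ (-(1 / 2 : ℝ)) with hc
  have hc0 : 0 < c := by positivity
  have hb : ∀ s : ℝ, eLpNorm (fun x => c * gaussKernel (2 * t) (x - s • y)) (ENNReal.ofReal p) volume ≤
      ENNReal.ofReal (2 ^ ((N : ℝ) / 2) * ‖y‖ * t ^ (-((N : ℝ) / 2 * (1 - 1 / p) + 1 / 2))) := by
    intro s
    have h1 := eLpNorm_comp_sub (continuous_gaussKernel (N := N) (2 * t)).aestronglyMeasurable
      (ENNReal.ofReal p) (s • y)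
    have h2 := eLpNorm_const_smul c (fun x => gaussKernel (N := N) (2 * t) (x - s • y))
      (ENNReal.ofReal p) volume
    have h3 : eLpNorm (fun x => c * gaussKernel (2 * t) (x - s • y)) (ENNReal.ofReal p) volume =
      ‖c‖ₑ * eLpNorm (gaussKernel (N := N) (2 * t)) (ENNReal.ofReal p) volume := by
      rw [← h1]
      exact h2
    rw [h3, Real.enorm_eq_ofReal hc0.le]
    refine (mul_le_mul_right (eLpNorm_gaussKernel_le hp (by positivity)) _).trans ?_
    rw [← ENNReal.ofReal_mul hc0.le]
    refine ENNReal.ofReal_le_ofReal ?_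
    have hg : 0 ≤ (N : ℝ) / 2 * (1 - 1 / p) := by
      have : 1 / p ≤ 1 := by rw [div_le_one hp0]; exact hp
      have : 0 ≤ 1 - 1 / p := by linarith
      positivity
    have h4 : (2 * t) ^ (-((N : ℝ) / 2 * (1 - 1 / p))) ≤ t ^ (-((N : ℝ) / 2 * (1 - 1 / p))) :=
      Real.rpow_le_rpow_of_nonpos ht (by linarith) (by linarith)
    refine (mul_le_mul_of_nonneg_left h4 hc0.le).trans_eq ?_
    rw [hc, mul_assoc, ← Real.rpow_add ht]
    congr 2
    ring
  have hm : Measurable (Function.uncurry fun (x : Sp N) (s : ℝ) =>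
      c * gaussKernel (2 * t) (x - s • y)) := by
    have := (continuous_gaussKernel (N := N) (2 * t)).measurable
    unfold Function.uncurry
    fun_prop
  refine (eLpNorm_le_lintegral (ν := volume.restrict (Set.Ioc (0 : ℝ) 1)) hp hm
    (a := fun _ => ENNReal.ofReal
      (2 ^ ((N : ℝ) / 2) * ‖y‖ * t ^ (-((N : ℝ) / 2 * (1 - 1 / p) + 1 / 2)))) measurable_const
    (Eventually.of_forall fun _ => ?_) (Eventually.of_forall fun _ => ENNReal.ofReal_ne_top)
    (Eventually.of_forall hb)
    (Eventually.of_forall fun x => enorm_gaussKernel_sub_le ht x y)).trans_eq ?_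
  · have : 0 < 2 ^ ((N : ℝ) / 2) * ‖y‖ * t ^ (-((N : ℝ) / 2 * (1 - 1 / p) + 1 / 2)) := by positivity
    simpa using this
  · simp

lemma measurable_mix {N : ℕ} (μ : Measure ℝ) [SFinite μ] : Measurable (mix (N := N) μ) :=
  (measurable_gaussKernel.stronglyMeasurable.integral_prod_right (ν := μ)).measurable

lemma eLpNorm_mix_le {N : ℕ} {μ : Measure ℝ} [IsFiniteMeasure μ] (hμ : ∀ᵐ t ∂μ, 0 < t) {p : ℝ}
    (hp : 1 ≤ p) :
    eLpNorm (mix (N := N) μ) (ENNReal.ofReal p) volume ≤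
      ∫⁻ t, ENNReal.ofReal (t ^ (-((N : ℝ) / 2 * (1 - 1 / p)))) ∂μ := by
  refine eLpNorm_le_lintegral hp (Φ := fun x t => gaussKernel t x) measurable_gaussKernel
    (by fun_prop) ?_ (Eventually.of_forall fun _ => ENNReal.ofReal_ne_top) ?_
    (Eventually.of_forall fun x => enorm_integral_le_lintegral_enorm _)
  · filter_upwards [hμ] with t ht
    have : 0 < t ^ (-((N : ℝ) / 2 * (1 - 1 / p))) := by positivity
    simpa using this
  · filter_upwards [hμ] with t ht
    exact eLpNorm_gaussKernel_le hp ht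

lemma eLpNorm_mix_sub_le {N : ℕ} {μ : Measure ℝ} [IsFiniteMeasure μ] (hμ : ∀ᵐ t ∂μ, 0 < t) {p : ℝ}
    (hp : 1 ≤ p) (y : Sp N) :
    eLpNorm (fun x => mix (N := N) μ (x - y) - mix μ x) (ENNReal.ofReal p) volume ≤
      ENNReal.ofReal (2 ^ ((N : ℝ) / 2) * ‖y‖) *
        ∫⁻ t, ENNReal.ofReal (t ^ (-((N : ℝ) / 2 * (1 - 1 / p) + 1 / 2))) ∂μ := by
  by_cases hy : y = 0
  · simp [hy]
  have hy' : 0 < ‖y‖ := norm_pos_iff.mpr hy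
  rw [← lintegral_const_mul _ (by fun_prop)]
  have hm : Measurable (Function.uncurry fun (x : Sp N) (t : ℝ) =>
      gaussKernel t (x - y) - gaussKernel t x) := by
    refine Measurable.sub ?_ measurable_gaussKernel
    exact measurable_gaussKernel.comp ((measurable_fst.sub_const y).prodMk measurable_snd)
  refine eLpNorm_le_lintegral hp hm (by fun_prop) ?_ ?_ ?_ ?_
  · filter_upwards [hμ] with t ht
    have : 0 < 2 ^ ((N : ℝ) / 2) * ‖y‖ := by positivity
    have h2 : 0 < t ^ (-((N : ℝ) / 2 * (1 - 1 / p) + 1 / 2)) := by positivity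
    exact mul_ne_zero (by simpa using this) (by simpa using h2)
  · exact Eventually.of_forall fun t =>
      ENNReal.mul_ne_top ENNReal.ofReal_ne_top ENNReal.ofReal_ne_top
  · filter_upwards [hμ] with t ht
    rw [← ENNReal.ofReal_mul (by positivity)]
    exact eLpNorm_gaussKernel_sub_le hp ht y
  -- The two mixtures can be subtracted under one integral only where both converge; Fubini gives
  -- almost every `x`, and translation preserves null sets.
  · have h1 : ∀ᵐ x : Sp N, Integrable (fun t => gaussKernel t x) μ :=
      (integrable_gaussKernel_prod hμ).prod_right_ae
    have h2 : ∀ᵐ x : Sp N, Integrable (fun t => gaussKernel t (x - y)) μ :=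
      (measurePreserving_sub_right volume y).quasiMeasurePreserving.ae h1
    filter_upwards [h1, h2] with x hx1 hx2
    rw [mix, mix, ← integral_sub hx2 hx1]
    exact enorm_integral_le_lintegral_enorm _

/-- The distance in `L^p` between a convolution `K * f` and `(∫ f) K` is controlled by the moduli of
continuity of `K`. -/
theorem eLpNorm_conv_sub_le {N : ℕ} {K f : Sp N → ℝ} (hK : Integrable K) (hKm : Measurable K)
    (hf : Integrable f) {p : ℝ} (hp : 1 ≤ p) {b : Sp N → ℝ≥0∞} (hbm : Measurable b)
    (hb0 : ∀ᵐ y, b y ≠ 0) (hbtop : ∀ y, b y ≠ ⊤)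
    (hb : ∀ y, eLpNorm (fun x => K (x - y) - K x) (ENNReal.ofReal p) volume ≤ b y) :
    eLpNorm (fun x => (∫ y, K (x - y) * f y) - (∫ y, f y) * K x) (ENNReal.ofReal p) volume ≤
      ∫⁻ y, ‖f y‖ₑ * b y := by
  have hfm : AEMeasurable (fun y => ‖f y‖ₑ) volume := hf.1.enorm
  -- The weight `‖f‖ₑ` goes into the measure, so that the majorant `b` stays nonzero even where `f`
  -- vanishes.
  rw [show (fun y => ‖f y‖ₑ * b y) = (fun y => ‖f y‖ₑ) * b from rfl,
    ← lintegral_withDensity_eq_lintegral_mul₀ hfm hbm.aemeasurable]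
  have hm : Measurable (Function.uncurry fun x y : Sp N => K (x - y) - K x) :=
    (hKm.comp (measurable_fst.sub measurable_snd)).sub (hKm.comp measurable_fst)
  refine eLpNorm_le_lintegral hp hm hbm
    ((withDensity_absolutelyContinuous _ _).ae_le hb0) (Eventually.of_forall hbtop)
    (Eventually.of_forall hb) ?_
  have hconv := hf.ae_convolution_exists (ContinuousLinearMap.mul ℝ ℝ) hK
  filter_upwards [hconv] with x hx
  have hx' : Integrable fun y => K (x - y) * f y := by
    refine (show Integrable (fun y => f y * K (x - y)) volume from hx).congr
      (Eventually.of_forall fun y => mul_comm _ _)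
  have hmx : Measurable fun y => K (x - y) - K x := hm.comp measurable_prodMk_left
  rw [lintegral_withDensity_eq_lintegral_mul₀ hfm hmx.enorm.aemeasurable, ← integral_mul_const,
    ← integral_sub hx' (hf.mul_const _)]
  refine (enorm_integral_le_lintegral_enorm _).trans_eq (lintegral_congr fun y => ?_)
  rw [Pi.mul_apply, ← enorm_mul]
  congr 1
  ring

/-! ### Large-time behaviour -/

section

variable {N : ℕ} {α : ℝ}

lemma moment_exponent_nonneg (N : ℕ) {p : ℝ} (hp : 1 ≤ p) :
    0 ≤ (N : ℝ) / 2 * (1 - 1 / p) := by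
  have : 1 / p ≤ 1 := by rw [div_le_one (by linarith)]; exact hp
  have : 0 ≤ 1 - 1 / p := by linarith
  positivity

/-- The range of `p` enters here: the condition says `N (1 - 1/p) < 1`, so the moment with the
additional gradient exponent `1/2` still has order less than one. -/
lemma moment_exponent_lt (hN : 1 ≤ N) {p : ℝ} (hp : 1 ≤ p)
    (hpN : 1 < N → p < (N : ℝ) / ((N : ℝ) - 1)) : (N : ℝ) / 2 * (1 - 1 / p) + 1 / 2 < 1 := by
  have hp0 : 0 < p := by linarith
  rcases hN.eq_or_lt with rfl | h1
  · have : 0 < 1 / p := by positivity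
    rw [Nat.cast_one]
    linarith
  · have hN1 : (1 : ℝ) < N := by exact_mod_cast h1
    have h2 := hpN h1
    rw [lt_div_iff₀ (by linarith)] at h2
    have h3 : (N : ℝ) - 1 < N / p := by rw [lt_div_iff₀ hp0]; linarith
    have e : (N : ℝ) / 2 * (1 - 1 / p) = (N - N / p) / 2 := by ring
    rw [e]
    linarith

lemma ae_ne_zero (hN : 1 ≤ N) : ∀ᵐ y : Sp N, y ≠ 0 := by
  have : Nonempty (Fin N) := ⟨⟨0, hN⟩⟩
  exact Measure.ae_ne volume 0

/-- The two `L^p` moduli of continuity of the fundamental solution. -/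
lemma eLpNorm_fundamental_sub_le (hN : 1 ≤ N) (h0 : 0 ≤ α) (h1 : α ≤ 1) {p : ℝ} (hp : 1 ≤ p)
    (hpN : 1 < N → p < (N : ℝ) / ((N : ℝ) - 1)) {h : ℝ} (hh : 0 < h) {n : ℕ} (hn : 1 ≤ n)
    (y : Sp N) :
    eLpNorm (fun x => mix (N := N) (mixMeasure α h n) (x - y) - mix (mixMeasure α h n) x)
        (ENNReal.ofReal p) volume ≤
      ENNReal.ofReal (((n : ℝ) * h) ^ (-(α * (N : ℝ) / 2 * (1 - 1 / p))) *
        min (2 * Real.Gamma (1 - (N : ℝ) / 2 * (1 - 1 / p)))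
          (2 ^ ((N : ℝ) / 2) * Real.Gamma (1 - ((N : ℝ) / 2 * (1 - 1 / p) + 1 / 2)) * ‖y‖ *
            ((n : ℝ) * h) ^ (-(α / 2)))) := by
  have := isFiniteMeasure_mixMeasure α hh n
  have hn' : (0 : ℝ) < n := by exact_mod_cast hn
  have hnh : 0 < (n : ℝ) * h := by positivity
  set γ := (N : ℝ) / 2 * (1 - 1 / p) with hγ
  have hγ0 : 0 ≤ γ := moment_exponent_nonneg N hp
  have hγ1 : γ + 1 / 2 < 1 := moment_exponent_lt hN hp hpN
  have hpos := mixMeasure_pos α h n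
  have hG1 : 0 < Real.Gamma (1 - γ) := Real.Gamma_pos_of_pos (by linarith)
  have hG2 : 0 < Real.Gamma (1 - (γ + 1 / 2)) := Real.Gamma_pos_of_pos (by linarith)
  have eγ : α * (N : ℝ) / 2 * (1 - 1 / p) = α * γ := by rw [hγ]; ring
  rw [eγ, mul_min_of_nonneg _ _ (by positivity), ENNReal.ofReal_min]
  -- The first bound is the triangle inequality and ignores `y`; the second is the gradient
  -- estimate, with the extra decay `(nh) ^ (-α/2)`.
  refine le_min ?_ ?_
  · have hm := (measurable_mix (N := N) (mixMeasure α h n)).aestronglyMeasurable (μ := volume)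
    have hp1 : 1 ≤ ENNReal.ofReal p := by simpa using hp
    refine (eLpNorm_sub_le (f := fun x => mix (N := N) (mixMeasure α h n) (x - y))
      (hm.comp_measurePreserving (measurePreserving_sub_right volume y)) hm hp1).trans ?_
    rw [eLpNorm_comp_sub hm, ← two_mul]
    refine (mul_le_mul_right ((eLpNorm_mix_le hpos hp).trans
      (lintegral_mixMeasure_rpow_neg_le h0 h1 hh hγ0 (by linarith) hn)) 2).trans_eq ?_
    rw [show (2 : ℝ≥0∞) = ENNReal.ofReal 2 by simp, ← ENNReal.ofReal_mul (by norm_num)]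
    congr 1
    ring
  · refine (eLpNorm_mix_sub_le hpos hp y).trans ?_
    refine (mul_le_mul_right
      (lintegral_mixMeasure_rpow_neg_le h0 h1 hh (by linarith) hγ1 hn) _).trans_eq ?_
    rw [← ENNReal.ofReal_mul (by positivity), show -(α * (γ + 1 / 2)) = -(α * γ) + -(α / 2) by ring,
      Real.rpow_add hnh]
    congr 1
    ring

/-- Bound of the scaled distance between a solution and the multiple of the fundamental solution
with the same mass. -/
lemma scaled_eLpNorm_le (hN : 1 ≤ N) (h0 : 0 ≤ α) (h1 : α ≤ 1) {f : Sp N → ℝ} (hf : Integrable f)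
    {p : ℝ} (hp : 1 ≤ p) (hpN : 1 < N → p < (N : ℝ) / ((N : ℝ) - 1)) {h : ℝ} (hh : 0 < h)
    {u K : ℕ → Sp N → ℝ} (hu : IsSolution α h f u) (hK : IsFundamentalSolution α h K) {n : ℕ}
    (hn : 1 ≤ n) :
    ENNReal.ofReal (((n : ℝ) * h) ^ (α * (N : ℝ) / 2 * (1 - 1 / p))) *
        eLpNorm (fun x => u n x - (∫ y, f y) * K n x) (ENNReal.ofReal p) volume ≤
      ∫⁻ y, ‖f y‖ₑ * ENNReal.ofReal (min (2 * Real.Gamma (1 - (N : ℝ) / 2 * (1 - 1 / p)))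
          (2 ^ ((N : ℝ) / 2) * Real.Gamma (1 - ((N : ℝ) / 2 * (1 - 1 / p) + 1 / 2)) * ‖y‖ *
            ((n : ℝ) * h) ^ (-(α / 2)))) := by
  have := isFiniteMeasure_mixMeasure α hh n
  have hn' : (0 : ℝ) < n := by exact_mod_cast hn
  have hnh : 0 < (n : ℝ) * h := by positivity
  have hγ0 := moment_exponent_nonneg N hp
  have hγ1 := moment_exponent_lt hN hp hpN
  have hG1 : 0 < Real.Gamma (1 - (N : ℝ) / 2 * (1 - 1 / p)) := Real.Gamma_pos_of_pos (by linarith)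
  have hG2 : 0 < Real.Gamma (1 - ((N : ℝ) / 2 * (1 - 1 / p) + 1 / 2)) :=
    Real.Gamma_pos_of_pos (by linarith)
  set m : Sp N → ℝ := fun y => min (2 * Real.Gamma (1 - (N : ℝ) / 2 * (1 - 1 / p)))
    (2 ^ ((N : ℝ) / 2) * Real.Gamma (1 - ((N : ℝ) / 2 * (1 - 1 / p) + 1 / 2)) * ‖y‖ *
      ((n : ℝ) * h) ^ (-(α / 2))) with hm
  have hmix := isFundamentalSolution_mix (N := N) h0 h1 hh
  have hae : (fun x => u n x - (∫ y, f y) * K n x) =ᵐ[volume] fun x =>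
      (∫ y, mix (mixMeasure α h n) (x - y) * f y) - (∫ y, f y) * mix (mixMeasure α h n) x := by
    filter_upwards [solution_eq_conv hh hf hu hmix n hn, fundamentalSolution_unique hh hmix hK n hn]
      with x hx1 hx2
    rw [hx1, hx2]
  rw [eLpNorm_congr_ae hae]
  have hmm : Measurable m := by rw [hm]; fun_prop
  set r : ℝ := α * (N : ℝ) / 2 * (1 - 1 / p) with hr
  have hle := eLpNorm_conv_sub_le (hmix.integrable n hn) (measurable_mix _) hf hp
    (b := fun y => ENNReal.ofReal (((n : ℝ) * h) ^ (-r) * m y)) (by fun_prop) (by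
      filter_upwards [ae_ne_zero hN] with y hy
      have hy' : 0 < ‖y‖ := norm_pos_iff.mpr hy
      have : 0 < ((n : ℝ) * h) ^ (-r) * m y := by
        refine mul_pos (by positivity) (lt_min (by positivity) (by positivity))
      simpa using this) (fun _ => ENNReal.ofReal_ne_top)
    (fun y => eLpNorm_fundamental_sub_le hN h0 h1 hp hpN hh hn y)
  refine (mul_le_mul_right hle _).trans_eq ?_
  rw [← lintegral_const_mul' _ _ ENNReal.ofReal_ne_top]
  refine lintegral_congr fun y => ?_
  rw [mul_left_comm, ← ENNReal.ofReal_mul (by positivity), ← mul_assoc, ← Real.rpow_add hnh,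
    add_neg_cancel, Real.rpow_zero, one_mul]

/-- Dominated convergence in `y`: one alternative of the minimum supplies the integrable majorant `A
‖f‖`, the other tends to zero for each fixed `y`. -/
theorem tendsto_scaled_eLpNorm (hN : 1 ≤ N) (h0 : 0 < α) (h1 : α ≤ 1) {f : Sp N → ℝ}
    (hf : Integrable f) {p : ℝ} (hp : 1 ≤ p) (hpN : 1 < N → p < (N : ℝ) / ((N : ℝ) - 1)) {h : ℝ}
    (hh : 0 < h) {u K : ℕ → Sp N → ℝ} (hu : IsSolution α h f u)
    (hK : IsFundamentalSolution α h K) :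
    Tendsto (fun n : ℕ => ENNReal.ofReal (((n : ℝ) * h) ^ (α * (N : ℝ) / 2 * (1 - 1 / p))) *
      eLpNorm (fun x => u n x - (∫ y, f y) * K n x) (ENNReal.ofReal p) volume) atTop (𝓝 0) := by
  set A := 2 * Real.Gamma (1 - (N : ℝ) / 2 * (1 - 1 / p))
  set B := 2 ^ ((N : ℝ) / 2) * Real.Gamma (1 - ((N : ℝ) / 2 * (1 - 1 / p) + 1 / 2))
  have hA : 0 ≤ A := by
    have := moment_exponent_lt hN hp hpN
    have : 0 < Real.Gamma (1 - (N : ℝ) / 2 * (1 - 1 / p)) := Real.Gamma_pos_of_pos (by linarith)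
    positivity
  have hlim : Tendsto (fun n : ℕ => ∫⁻ y, ‖f y‖ₑ *
      ENNReal.ofReal (min A (B * ‖y‖ * ((n : ℝ) * h) ^ (-(α / 2))))) atTop
      (𝓝 (∫⁻ _ : Sp N, 0)) := by
    refine tendsto_lintegral_of_dominated_convergence' (fun y => ‖f y‖ₑ * ENNReal.ofReal A)
      (fun n => hf.1.enorm.mul (by fun_prop))
      (fun n => Eventually.of_forall fun y => ?_) ?_ (Eventually.of_forall fun y => ?_)
    · exact mul_le_mul_right (ENNReal.ofReal_le_ofReal (min_le_left _ _)) _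
    · rw [lintegral_mul_const' _ _ ENNReal.ofReal_ne_top]
      exact ENNReal.mul_ne_top hf.2.ne ENNReal.ofReal_ne_top
    · have hr : Tendsto (fun n : ℕ => ((n : ℝ) * h) ^ (-(α / 2))) atTop (𝓝 0) :=
        (tendsto_rpow_neg_atTop (by positivity)).comp
          (tendsto_natCast_atTop_atTop.atTop_mul_const hh)
      have hmin : Tendsto (fun n : ℕ => min A (B * ‖y‖ * ((n : ℝ) * h) ^ (-(α / 2)))) atTop
          (𝓝 0) := by
        have := (tendsto_const_nhds (x := A)).min (hr.const_mul (B * ‖y‖))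
        rwa [mul_zero, min_eq_right hA] at this
      have := ENNReal.Tendsto.const_mul (ENNReal.tendsto_ofReal hmin)
        (Or.inr (enorm_ne_top (x := f y)))
      simpa using this
  rw [lintegral_zero] at hlim
  refine tendsto_of_tendsto_of_tendsto_of_le_of_le' tendsto_const_nhds hlim
    (Eventually.of_forall fun _ => zero_le) ?_
  filter_upwards [eventually_ge_atTop 1] with n hn
  exact scaled_eLpNorm_le hN h0.le h1 hf hp hpN hh hu hK hn

theorem exists_scaled_eLpNorm_le (hN : 1 ≤ N) (h0 : 0 ≤ α) (h1 : α ≤ 1) {f : Sp N → ℝ}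
    (hf : Integrable f) {p : ℝ} (hp : 1 ≤ p) (hpN : 1 < N → p < (N : ℝ) / ((N : ℝ) - 1))
    (hxf : Integrable fun x => ‖x‖ * f x) :
    ∃ C : ℝ, ∀ h : ℝ, 0 < h → ∀ u K : ℕ → Sp N → ℝ, IsSolution α h f u →
      IsFundamentalSolution α h K → ∀ n : ℕ, 1 ≤ n →
        ENNReal.ofReal (((n : ℝ) * h) ^ (α * (N : ℝ) / 2 * (1 - 1 / p))) *
          eLpNorm (fun x => u n x - (∫ y, f y) * K n x) (ENNReal.ofReal p) volume
          ≤ ENNReal.ofReal (C * ((n : ℝ) * h) ^ (-(α / 2))) := by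
  set B := 2 ^ ((N : ℝ) / 2) * Real.Gamma (1 - ((N : ℝ) / 2 * (1 - 1 / p) + 1 / 2)) with hB
  have hB0 : 0 ≤ B := by
    have := moment_exponent_lt hN hp hpN
    have : 0 < Real.Gamma (1 - ((N : ℝ) / 2 * (1 - 1 / p) + 1 / 2)) :=
      Real.Gamma_pos_of_pos (by linarith)
    positivity
  -- The constant is the first absolute moment of `f` times the gradient constant; only the second
  -- alternative of the minimum is kept.
  refine ⟨(∫ x, ‖‖x‖ * f x‖) * B, fun h hh u K hu hK n hn => ?_⟩
  have hn' : (0 : ℝ) < n := by exact_mod_cast hn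
  have hnh : 0 < (n : ℝ) * h := by positivity
  refine (scaled_eLpNorm_le hN h0 h1 hf hp hpN hh hu hK hn).trans ?_
  have hI : 0 ≤ ∫ x, ‖‖x‖ * f x‖ := integral_nonneg fun _ => norm_nonneg _
  rw [mul_assoc, ENNReal.ofReal_mul hI, ofReal_integral_norm_eq_lintegral_enorm hxf,
    ← lintegral_mul_const' _ _ ENNReal.ofReal_ne_top]
  refine lintegral_mono fun y => ?_
  refine (mul_le_mul_right (ENNReal.ofReal_le_ofReal (min_le_right _ _)) _).trans_eq ?_
  rw [enorm_mul, mul_comm ‖‖y‖‖ₑ, mul_assoc ‖f y‖ₑ, Real.enorm_eq_ofReal (norm_nonneg y),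
    ← ENNReal.ofReal_mul (norm_nonneg y)]
  congr 2
  ring

end

end

end DiscreteFracHeat

theorem theorem6p5 (N : ℕ) (hN : 1 ≤ N) (α : ℝ) (hα0 : 0 < α) (hα1 : α < 1)
    (f : DiscreteFracHeat.Sp N → ℝ) (hf : Integrable f) :
    -- for every `h > 0` the fundamental solution exists and is unique, and the solution
    -- exists, is unique, and is the convolution of the fundamental solution with `f`
    (∀ h : ℝ, 0 < h → ∃ K : ℕ → DiscreteFracHeat.Sp N → ℝ,
      DiscreteFracHeat.IsFundamentalSolution α h K ∧
      (∀ K' : ℕ → DiscreteFracHeat.Sp N → ℝ, DiscreteFracHeat.IsFundamentalSolution α h K' →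
        ∀ n, 1 ≤ n → K' n =ᵐ[volume] K n) ∧
      (∃ u : ℕ → DiscreteFracHeat.Sp N → ℝ, DiscreteFracHeat.IsSolution α h f u) ∧
      (∀ u : ℕ → DiscreteFracHeat.Sp N → ℝ, DiscreteFracHeat.IsSolution α h f u →
        ∀ n, 1 ≤ n → u n =ᵐ[volume] fun x => ∫ y, K n (x - y) * f y)) ∧
    -- the subordination series is this fundamental solution for those `h` for which it converges
    -- for every `n`
    (∀ h : ℝ, 0 < h → h ^ (1 - α) < 2 →
      (∀ n : ℕ, 1 ≤ n → ∀ x : DiscreteFracHeat.Sp N, x ≠ 0 →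
        Summable fun j : ℕ => DiscreteFracHeat.wright α (1 - α) h (n - 1) j *
          DiscreteFracHeat.discreteGauss h (j + 1) x) ∧
      DiscreteFracHeat.IsFundamentalSolution α h
        (DiscreteFracHeat.subordKernel (N := N) α h)) ∧
    -- large-time behaviour
    (∀ p : ℝ, 1 ≤ p → (1 < N → p < (N : ℝ) / ((N : ℝ) - 1)) →
      (∀ h : ℝ, 0 < h → ∀ u K : ℕ → DiscreteFracHeat.Sp N → ℝ,
        DiscreteFracHeat.IsSolution α h f u → DiscreteFracHeat.IsFundamentalSolution α h K →
        Tendsto (fun n : ℕ =>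
          ENNReal.ofReal (((n : ℝ) * h) ^ (α * (N : ℝ) / 2 * (1 - 1 / p))) *
            eLpNorm (fun x => u n x - (∫ y, f y) * K n x) (ENNReal.ofReal p) volume)
          atTop (𝓝 0)) ∧
      (Integrable (fun x => ‖x‖ * f x) →
        ∃ C : ℝ, ∀ h : ℝ, 0 < h → ∀ u K : ℕ → DiscreteFracHeat.Sp N → ℝ,
          DiscreteFracHeat.IsSolution α h f u → DiscreteFracHeat.IsFundamentalSolution α h K →
          ∀ n : ℕ, 1 ≤ n →
            ENNReal.ofReal (((n : ℝ) * h) ^ (α * (N : ℝ) / 2 * (1 - 1 / p))) *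
              eLpNorm (fun x => u n x - (∫ y, f y) * K n x) (ENNReal.ofReal p) volume
              ≤ ENNReal.ofReal (C * ((n : ℝ) * h) ^ (-(α / 2))))) := by

  refine ⟨fun h hh => ?_, fun h hh h2 => ⟨fun n _ x hx => ?_, ?_⟩, fun p hp hpN => ⟨?_, ?_⟩⟩
  -- The witness is the Gaussian mixture, available for every `h`; the subordination series needs `h
  -- ^ (1 - α) < 2`.
  · have hK := DiscreteFracHeat.isFundamentalSolution_mix (N := N) hα0.le hα1.le hh
    exact ⟨_, hK, fun K' hK' => DiscreteFracHeat.fundamentalSolution_unique hh hK hK',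
      DiscreteFracHeat.exists_solution hh hf hK,
      fun u hu => DiscreteFracHeat.solution_eq_conv hh hf hu hK⟩
  · exact DiscreteFracHeat.summable_subord hN hh h2 (n - 1) hx
  · exact DiscreteFracHeat.isFundamentalSolution_subordKernel hN hh h2
  · exact fun h hh u K hu hK =>
      DiscreteFracHeat.tendsto_scaled_eLpNorm hN hα0 hα1.le hf hp hpN hh hu hK
  · exact DiscreteFracHeat.exists_scaled_eLpNorm_le hN hα0.le hα1.le hf hp hpN
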